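/- **Definitions.** For an $n$-dimensional Riemannian manifold $M$ without boundary and a compact set $K\subset M$, put $$w_M(K):=\inf\{\sup h-\inf h \mid h\in C_0^\infty(M),\ |dh|\ge 1 \text{ on } K\}\in[0,\infty],\qquad w(M):=\sup_{K\subset M\text{ compact}} w_M(K),$$ where $w(M)$ is called the width of $M$. For a simplicial complex $X$ with vertex set $V(X)$ (every vertex being a simplex), let $|\sigma|$ and $|X|=\bigcup_\sigma|\sigma|$ denote the closed geometric simplices and the geometric realization in $\mathbb R[V(X)]=\bigoplus_{v\in V(X)}\mathbb R v$, with the metric induced by the standard Euclidean metric. A $C^\infty$ triangulation of a manifold $N$ is a pair $(X,F)$ where $F:|X|\to N$ is a homeomorphism that is smooth on every $|\sigma|$ and such that, for every $x\in|X|$, the map $y\mapsto d(F|_{|\sigma|})_x(y-x)$ (for $x,y\in|\sigma|$) is injective on the closed star of $x$, that is, on the union of the closed simplices containing $x$. **Proposition.** Let $n$ be a dimension and let $c_0,c_1,c_2>0$ be constants (fixed once and for all for each $n$), $c_2$ being an integer. There is a constant $C>0$, depending only on $n$ and on $c_0,c_1,c_2$ (hence only on $n$), such that the following holds. Let $N$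 be a closed $n$-dimensional Riemannian manifold, let $\varepsilon>0$, and let $(X,F)$ be a $C^\infty$ triangulation of $N$ such that 1. for every edge $\sigma$ of $X$, $F|_{|\sigma|}$ is a geodesic (for the affine parametrization of $|\sigma|$); 2. for every simplex $\sigma$ of $X$ and every non-zero tangent vector $\xi$ on $|\sigma|$, $\ |d(F|_{|\sigma|})(\xi)|_N/|\xi|\in[c_0\varepsilon,c_1\varepsilon]$; 3. every vertex of $X$ is joined by edges to at most $c_2$ other vertices. Then $$w\bigl(N\setminus F(V(X))\bigr)\le C\,\varepsilon .$$ -/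

import Mathlib

open scoped Manifold ContDiff ENNReal
open TopologicalSpace (Opens)

noncomputable section

/-! ## Width of a Riemannian manifold -/

section Width

variable {n : ℕ} {M : Type*} [TopologicalSpace M] [ChartedSpace (EuclideanSpace ℝ (Fin n)) M]

/-- A field of bilinear forms on the tangent spaces of `M`; Riemannian metrics are regarded as such
fields where only their values matter. -/
abbrev TangentForm (n : ℕ) (M : Type*) [TopologicalSpace M]
    [ChartedSpace (EuclideanSpace ℝ (Fin n)) M] : Type _ :=
  ∀ x : M, TangentSpace (𝓡 n) x →L[ℝ] TangentSpace (𝓡 n) x →L[ℝ] ℝ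

/-- A smooth Riemannian metric on `M`. -/
abbrev SmoothMetric (n : ℕ) (M : Type*) [TopologicalSpace M]
    [ChartedSpace (EuclideanSpace ℝ (Fin n)) M] [IsManifold (𝓡 n) ∞ M] : Type _ :=
  Bundle.ContMDiffRiemannianMetric (𝓡 n) ∞ (EuclideanSpace ℝ (Fin n))
    (fun x : M => TangentSpace (𝓡 n) x)

/-- The differential `dh_x`, as a linear form on the tangent space. -/
def differential (n : ℕ) {M : Type*} [TopologicalSpace M]
    [ChartedSpace (EuclideanSpace ℝ (Fin n)) M] (h : M → ℝ) (x : M) :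
    TangentSpace (𝓡 n) x →L[ℝ] ℝ :=
  mfderiv (𝓡 n) 𝓘(ℝ, ℝ) h x

/-- The dual norm `|dh|_x = sup {|dh_x(v)| : |v| ≤ 1}` of the differential of `h` at `x`. -/
def normDifferential (g : TangentForm n M) (h : M → ℝ) (x : M) : ℝ :=
  sSup {r : ℝ | ∃ v : TangentSpace (𝓡 n) x, g x v v ≤ 1 ∧ r = |differential n h x v|}

/-- `w_M(K)`, the infimum of `sup h - inf h` over the compactly supported smooth functions `h` on
`M` with `|dh| ≥ 1` on `K`. It is `∞` if there is no such function. -/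
def widthOf (g : TangentForm n M) (K : Set M) : ℝ≥0∞ :=
  ⨅ (h : M → ℝ) (_ : ContMDiff (𝓡 n) 𝓘(ℝ, ℝ) ∞ h) (_ : HasCompactSupport h)
    (_ : ∀ x ∈ K, 1 ≤ normDifferential g h x), ENNReal.ofReal ((⨆ x, h x) - ⨅ x, h x)

/-- The width `w(M)`, the supremum of `w_M(K)` over the compact subsets `K` of `M`. -/
def width (g : TangentForm n M) : ℝ≥0∞ :=
  ⨆ (K : Set M) (_ : IsCompact K), widthOf g K

/-- The differential at `x` of the inclusion of an open subset `U` into `M`. -/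
def inclusionDeriv (n : ℕ) {M : Type*} [TopologicalSpace M]
    [ChartedSpace (EuclideanSpace ℝ (Fin n)) M] (U : Opens M) (x : U) :
    TangentSpace (𝓡 n) x →L[ℝ] TangentSpace (𝓡 n) (x : M) :=
  mfderiv (𝓡 n) (𝓡 n) (Subtype.val : U → M) x

/-- The metric induced on an open subset `U` of `M`: the pullback of `g` under the inclusion `ι`,
`(v, w) ↦ g(dι v, dι w)`. -/
def restrictMetric (g : TangentForm n M) (U : Opens M) : TangentForm n U := fun x =>
  (ContinuousLinearMap.precomp ℝ (inclusionDeriv n U x)).comp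
    ((g (x : M)).comp (inclusionDeriv n U x))

end Width

/-! ## Geodesics -/

section Geodesic

variable {n : ℕ} {M : Type*} [TopologicalSpace M] [ChartedSpace (EuclideanSpace ℝ (Fin n)) M]

/-- The metric `g` read in the chart at `p`: its value at the coordinate vectors `a`, `b` at the
point with coordinates `z`. -/
def metricInChart (g : TangentForm n M) (p : M) (z a b : EuclideanSpace ℝ (Fin n)) : ℝ :=
  g ((extChartAt (𝓡 n) p).symm z)
    (mfderiv 𝓘(ℝ, EuclideanSpace ℝ (Fin n)) (𝓡 n) (extChartAt (𝓡 n) p).symm z a)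
    (mfderiv 𝓘(ℝ, EuclideanSpace ℝ (Fin n)) (𝓡 n) (extChartAt (𝓡 n) p).symm z b)

/-- Christoffel symbol of the first kind in the chart at `p`, i.e. `g(∇_a b, c)` for constant
coordinate vector fields `a`, `b`, `c`. -/
def christoffel (g : TangentForm n M) (p : M) (z a b c : EuclideanSpace ℝ (Fin n)) : ℝ :=
  (fderiv ℝ (fun y => metricInChart g p y b c) z a
    + fderiv ℝ (fun y => metricInChart g p y a c) z b
    - fderiv ℝ (fun y => metricInChart g p y a b) z c) / 2

/-- `γ` is a geodesic on the time set `s` (an interval): it is smooth and its covariant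
acceleration vanishes, i.e. in local coordinates `g(u'', c) + g(∇_{u'} u', c) = 0` for all `c`. -/
def IsGeodesicOn (g : TangentForm n M) (γ : ℝ → M) (s : Set ℝ) : Prop :=
  ContMDiffOn 𝓘(ℝ, ℝ) (𝓡 n) ∞ γ s ∧
  ∀ t ∈ s, ∀ c : EuclideanSpace ℝ (Fin n),
    let u : ℝ → EuclideanSpace ℝ (Fin n) := fun τ => extChartAt (𝓡 n) (γ t) (γ τ)
    metricInChart g (γ t) (u t) (derivWithin (derivWithin u s) s t) c
      + christoffel g (γ t) (u t) (derivWithin u s t) (derivWithin u s t) c = 0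

end Geodesic

/-! ## Simplicial complexes and triangulations -/

section Triangulation

variable {V : Type*}

/-- The Hilbert space `ℓ²(V)`. It contains `ℝ[V] = ⨁_{v ∈ V} ℝ v`, as the subspace of finitely
supported functions, with its standard metric. -/
abbrev VertexSpace (V : Type*) : Type _ := lp (fun _ : V => ℝ) 2

open Classical in
/-- The vertex `v`, seen as a basis vector of `ℝ[V]`. -/
def vertexVec (v : V) : VertexSpace V := lp.single 2 v (1 : ℝ)

/-- The closed geometric simplex `|σ|`. -/
def geomSimplex (σ : Finset V) : Set (VertexSpace V) := convexHull ℝ (vertexVec '' (σ : Set V))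

/-- The geometric realization `|X|`, with the metric of `ℝ[V]`. -/
def geomRealization (X : AbstractSimplicialComplex V) : Set (VertexSpace V) :=
  ⋃ σ ∈ X.faces, geomSimplex σ

open Classical in
/-- The set `N_X(u)` of the vertices joined to `u` by an edge. -/
def vertexNeighbors (X : AbstractSimplicialComplex V) (u : V) : Set V :=
  {w | w ≠ u ∧ ({u, w} : Finset V) ∈ X.faces}

variable {n : ℕ} {N : Type*} [TopologicalSpace N] [ChartedSpace (EuclideanSpace ℝ (Fin n)) N]

/-- The differential at `x` of the restriction of `F` to `|σ|`. Its values on vectors that are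
tangent to `|σ|` do not depend on the behaviour of `F` outside `|σ|`. -/
def simplexDeriv (n : ℕ) {N : Type*} [TopologicalSpace N]
    [ChartedSpace (EuclideanSpace ℝ (Fin n)) N] (F : VertexSpace V → N) (σ : Finset V)
    (x ξ : VertexSpace V) : TangentSpace (𝓡 n) (F x) :=
  mfderivWithin 𝓘(ℝ, VertexSpace V) (𝓡 n) F (geomSimplex σ) x ξ

/-- `(X, F)` is a `C^∞` triangulation of `N`. The map `F` matters only on `|X|`. -/
structure IsSmoothTriangulation (n : ℕ) {N : Type*} [TopologicalSpace N]
    [ChartedSpace (EuclideanSpace ℝ (Fin n)) N]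
    (X : AbstractSimplicialComplex V) (F : VertexSpace V → N) : Prop where
  /-- `F` is smooth on every closed simplex -/
  smooth : ∀ σ ∈ X.faces, ContMDiffOn 𝓘(ℝ, VertexSpace V) (𝓡 n) ∞ F (geomSimplex σ)
  /-- for every `x`, the map `y ↦ d(F|_{|σ|})_x (y - x)` (`x, y ∈ |σ|`) is injective on the closed
  star of `x`, the union of the closed simplices that contain `x` -/
  injective : ∀ x : VertexSpace V, ∀ σ ∈ X.faces, ∀ τ ∈ X.faces,
    x ∈ geomSimplex σ → x ∈ geomSimplex τ → ∀ y ∈ geomSimplex σ, ∀ z ∈ geomSimplex τ,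
    simplexDeriv n F σ x (y - x) = simplexDeriv n F τ x (z - x) → y = z
  /-- `F` is a homeomorphism from `|X|` onto `N` -/
  homeo : IsHomeomorph ((geomRealization X).domRestrict F)

open Classical in
/-- The `C^∞` triangulation `(X, F)` of `(N, g)` is thick at scale `ε` with constants
`c₀, c₁, c₂`. -/
structure IsThickTriangulation (g : TangentForm n N) (c₀ c₁ : ℝ) (c₂ : ℕ) (ε : ℝ)
    (X : AbstractSimplicialComplex V) (F : VertexSpace V → N) : Prop
    extends IsSmoothTriangulation n X F where
  /-- `F` maps every edge to a geodesic -/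
  geodesic : ∀ v w : V, v ≠ w → ({v, w} : Finset V) ∈ X.faces →
    IsGeodesicOn g (fun t : ℝ => F (AffineMap.lineMap (vertexVec v) (vertexVec w) t))
      (Set.Icc 0 1)
  /-- `|dF(ξ)| / |ξ| ∈ [c₀ ε, c₁ ε]` for all non-zero vectors `ξ` tangent to a simplex -/
  thick : ∀ σ ∈ X.faces, ∀ x ∈ geomSimplex σ, ∀ ξ ∈ vectorSpan ℝ (geomSimplex σ), ξ ≠ 0 →
    Real.sqrt (g (F x) (simplexDeriv n F σ x ξ) (simplexDeriv n F σ x ξ)) / ‖ξ‖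
      ∈ Set.Icc (c₀ * ε) (c₁ * ε)
  /-- every vertex has at most `c₂` neighbours -/
  degree : ∀ u : V, (vertexNeighbors X u).encard ≤ c₂

theorem one_le_dist_vertexVec {v w : V} (h : v ≠ w) :
    1 ≤ dist (vertexVec v) (vertexVec w) := by
  classical
  rw [dist_eq_norm]
  have h1 := lp.norm_apply_le_norm (p := 2) (by norm_num) (vertexVec v - vertexVec w) v
  have h2 : (vertexVec v - vertexVec w) v = 1 := by
    simp [vertexVec, h]
  rw [h2] at h1
  simpa using h1

theorem vertexVec_mem_geomRealization (X : AbstractSimplicialComplex V) (v : V) :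
    vertexVec v ∈ geomRealization X := by
  refine Set.mem_biUnion (X.singleton_mem v) ?_
  exact subset_convexHull ℝ _ ⟨v, by simp, rfl⟩

theorem isClosed_vertices {X : AbstractSimplicialComplex V} {F : VertexSpace V → N}
    (hF : IsSmoothTriangulation n X F) :
    IsClosed (Set.range fun v : V => F (vertexVec v)) := by
  have h1 : IsClosed (Set.range (vertexVec : V → VertexSpace V)) := by
    refine Metric.isClosed_of_pairwise_le_dist one_pos ?_
    rintro _ ⟨v, rfl⟩ _ ⟨w, rfl⟩ hvw
    exact one_le_dist_vertexVec fun h => hvw (by rw [h])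
  have h2 := hF.homeo.isClosedMap _ (h1.preimage continuous_subtype_val)
  convert h2 using 1
  ext p
  constructor
  · rintro ⟨v, rfl⟩
    exact ⟨⟨vertexVec v, vertexVec_mem_geomRealization X v⟩, ⟨v, rfl⟩, rfl⟩
  · rintro ⟨⟨y, hy⟩, ⟨v, rfl⟩, rfl⟩
    exact ⟨v, rfl⟩

/-- The open submanifold `N \ F(V(X))`, the complement of the vertices of a triangulation. -/
def vertexComplement {X : AbstractSimplicialComplex V} {F : VertexSpace V → N}
    (hF : IsSmoothTriangulation n X F) : Opens N :=
  ⟨(Set.range fun v : V => F (vertexVec v))ᶜ, (isClosed_vertices hF).isOpen_compl⟩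

end Triangulation

end

/-!
The estimate holds with `C = 4 c₁ (c₂ + 2)`. The idea is to smooth a function that is linear on each
simplex and whose only critical points, in the piecewise linear sense, are the vertices.

Since a vertex has at most `c₂` neighbours, the vertices can be coloured by `0, …, c₂` with distinct
colours on adjacent vertices (`exists_colouring`). Let `φ : N → [0, c₂]` be the function that is
linear on each simplex (in the coordinates given by `F`) and has the colours as vertex values. A
point `p` that is not a vertex has two vertices `a`, `b` in its carrier, of colours that differ by
at least `1`. The edge vector from `a` to `b` has length `√2` and is tangent to every simplex
through `p`, and the differentials of `F` on these simplices send it to one and the same tangent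
vector `Z`, of length at most `√2 c₁ ε`. In the direction `Z` the function `φ` grows at a rate of
about `1` on each simplex near `p`, because the derivative of `F` on each simplex is continuous and,
by thickness, bounded below. A short line segment in a chart may pass from one simplex to another
infinitely often, but a growth estimate to the right of each of its points integrates; so `φ` grows
at rate at least `3/4` along all segments near `p` with direction close to `Z`
(`exists_growth_along_lines`, `IsThickTriangulation.growsAlong_edge`).

This condition, `GrowsAlong`, does not involve derivatives of `φ`. It passes to the mollifications
of `φ` in charts, and to the function glued from these by a partition of unity, up to an error that
is small because the mollifications converge uniformly. The result is a smooth function `H` with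
`|H - φ| ≤ 1` whose differential is at least `1/2` on vectors of length at most `2 c₁ ε`, over a
given compact set of points that are not vertices (`exists_smooth_approx_of_growsAlong`). Cutting
`H` off near the vertices and multiplying by `4 c₁ ε` gives a competitor for the width with
oscillation at most `4 c₁ ε (c₂ + 2)` (`widthOf_restrict_le`).
-/

noncomputable section


/-! ### Simplices in barycentric coordinates -/

section SimplexGeometry

variable {V : Type*}

theorem vertexVec_apply_self (v : V) : vertexVec v v = 1 := by
  classical
  simp [vertexVec]

theorem vertexVec_apply_of_ne {v w : V} (h : w ≠ v) : vertexVec v w = 0 := by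
  classical
  simp [vertexVec, h]

theorem vertexVec_injective : Function.Injective (vertexVec : V → VertexSpace V) := by
  intro v w h
  by_contra hne
  have := one_le_dist_vertexVec hne
  rw [h, dist_self] at this
  linarith

theorem vertexSpace_add_apply (x y : VertexSpace V) (v : V) : (x + y) v = x v + y v := rfl

theorem vertexSpace_sub_apply (x y : VertexSpace V) (v : V) : (x - y) v = x v - y v := rfl

theorem vertexSpace_smul_apply (c : ℝ) (x : VertexSpace V) (v : V) : (c • x) v = c * x v := rfl

theorem vertexSpace_sum_apply {ι : Type*} (s : Finset ι) (f : ι → VertexSpace V) (v : V) :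
    (∑ i ∈ s, f i) v = ∑ i ∈ s, f i v := by
  rw [lp.coeFn_sum, Finset.sum_apply]

theorem sum_smul_vertexVec_apply (s : Finset V) (c : V → ℝ) {v : V} (hv : v ∈ s) :
    (∑ w ∈ s, c w • vertexVec w) v = c v := by
  classical
  rw [vertexSpace_sum_apply, Finset.sum_eq_single v]
  · simp [vertexVec_apply_self]
  · intro w _ hw
    simp [vertexVec_apply_of_ne hw.symm]
  · exact fun h => absurd hv h

theorem sum_smul_vertexVec_apply_of_notMem (s : Finset V) (c : V → ℝ) {v : V} (hv : v ∉ s) :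
    (∑ w ∈ s, c w • vertexVec w) v = 0 := by
  classical
  rw [vertexSpace_sum_apply]
  refine Finset.sum_eq_zero fun w hw => ?_
  have : v ≠ w := fun h => hv (h ▸ hw)
  simp [vertexVec_apply_of_ne this]

/-- The closed simplex `|σ|` in barycentric coordinates. -/
theorem mem_geomSimplex_iff {σ : Finset V} {x : VertexSpace V} :
    x ∈ geomSimplex σ ↔ (∀ v, 0 ≤ x v) ∧ (∀ v ∉ σ, x v = 0) ∧ ∑ v ∈ σ, x v = 1 := by
  classical
  constructor
  · intro hx
    have hconv : Convex ℝ {x : VertexSpace V |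
        (∀ v, 0 ≤ x v) ∧ (∀ v ∉ σ, x v = 0) ∧ ∑ v ∈ σ, x v = 1} := by
      rintro x ⟨hx0, hxσ, hx1⟩ y ⟨hy0, hyσ, hy1⟩ a b ha hb hab
      refine ⟨fun v => ?_, fun v hv => ?_, ?_⟩
      · have := hx0 v
        have := hy0 v
        simp only [vertexSpace_add_apply, vertexSpace_smul_apply]
        positivity
      · simp [vertexSpace_add_apply, vertexSpace_smul_apply, hxσ v hv, hyσ v hv]
      · simp only [vertexSpace_add_apply, vertexSpace_smul_apply,
          Finset.sum_add_distrib, ← Finset.mul_sum, hx1, hy1]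
        linarith
    refine convexHull_min ?_ hconv hx
    rintro _ ⟨w, hw, rfl⟩
    refine ⟨fun v => ?_, fun v hv => ?_, ?_⟩
    · by_cases h : v = w
      · subst h; simp [vertexVec_apply_self]
      · simp [vertexVec_apply_of_ne h]
    · exact vertexVec_apply_of_ne fun h => hv (h ▸ hw)
    · rw [Finset.sum_eq_single w]
      · exact vertexVec_apply_self w
      · exact fun v _ hv => vertexVec_apply_of_ne hv
      · exact fun h => absurd hw h
  · rintro ⟨h0, hσ, h1⟩
    have hx : x = ∑ v ∈ σ, x v • vertexVec v := by
      ext v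
      by_cases hv : v ∈ σ
      · rw [sum_smul_vertexVec_apply σ _ hv]
      · rw [sum_smul_vertexVec_apply_of_notMem σ _ hv, hσ v hv]
    rw [hx]
    exact (convex_convexHull ℝ _).sum_mem (fun v _ => h0 v) h1
      fun v hv => subset_convexHull ℝ _ ⟨v, hv, rfl⟩

theorem convex_geomSimplex (σ : Finset V) : Convex ℝ (geomSimplex σ) := convex_convexHull ℝ _

theorem isClosed_geomSimplex (σ : Finset V) : IsClosed (geomSimplex σ) :=
  (σ.finite_toSet.image _).isClosed_convexHull ℝ

theorem sub_mem_vectorSpan_geomSimplex {σ : Finset V} {x y : VertexSpace V}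
    (hx : x ∈ geomSimplex σ) (hy : y ∈ geomSimplex σ) :
    y - x ∈ vectorSpan ℝ (geomSimplex σ) := vsub_mem_vectorSpan ℝ hy hx

instance finiteDimensional_vectorSpan_geomSimplex (σ : Finset V) :
    FiniteDimensional ℝ (vectorSpan ℝ (geomSimplex σ)) := by
  rw [geomSimplex, ← direction_affineSpan, affineSpan_convexHull, direction_affineSpan]
  exact finiteDimensional_vectorSpan_of_finite ℝ (σ.finite_toSet.image _)

theorem vertexVec_mem_geomSimplex {σ : Finset V} {v : V} (hv : v ∈ σ) :
    vertexVec v ∈ geomSimplex σ := subset_convexHull ℝ _ ⟨v, hv, rfl⟩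

theorem mem_of_apply_pos {σ : Finset V} {x : VertexSpace V} (hx : x ∈ geomSimplex σ) {v : V}
    (hv : 0 < x v) : v ∈ σ := by
  by_contra h
  rw [(mem_geomSimplex_iff.1 hx).2.1 v h] at hv
  exact lt_irrefl _ hv

/-- A point of a simplex that is not a vertex has two positive barycentric coordinates. -/
theorem exists_two_pos_of_ne_vertexVec {σ : Finset V} {x : VertexSpace V}
    (hx : x ∈ geomSimplex σ) (hne : ∀ v, x ≠ vertexVec v) :
    ∃ a b, a ≠ b ∧ 0 < x a ∧ 0 < x b := by
  classical
  obtain ⟨h0, hσ, h1⟩ := mem_geomSimplex_iff.1 hx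
  obtain ⟨a, ha, hxa⟩ : ∃ a ∈ σ, 0 < x a := by
    by_contra! h
    have := Finset.sum_nonpos h
    linarith
  by_contra! h
  refine hne a ?_
  have hz : ∀ v, v ≠ a → x v = 0 := fun v hv => le_antisymm (h a v hv.symm hxa) (h0 v)
  ext v
  by_cases hv : v = a
  · subst hv
    rw [vertexVec_apply_self, ← h1, Finset.sum_eq_single v (fun w _ hw => hz w hw)]
    exact fun h => absurd ha h
  · rw [hz v hv, vertexVec_apply_of_ne hv]

/-- Transferring the whole weight of the vertex `a` to the vertex `b` stays in every simplex
containing both vertices. -/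
theorem add_smul_edge_mem_geomSimplex {σ : Finset V} {x : VertexSpace V}
    (hx : x ∈ geomSimplex σ) {a b : V} (ha : a ∈ σ) (hb : b ∈ σ) :
    x + x a • (vertexVec b - vertexVec a) ∈ geomSimplex σ := by
  classical
  by_cases hab : a = b
  · subst hab; simpa using hx
  obtain ⟨h0, hσ, h1⟩ := mem_geomSimplex_iff.1 hx
  refine mem_geomSimplex_iff.2 ⟨fun v => ?_, fun v hv => ?_, ?_⟩
  · have h1 := h0 v
    have h2 := h0 a
    by_cases hva : v = a
    · subst hva
      simp [vertexSpace_add_apply, vertexSpace_smul_apply, vertexSpace_sub_apply,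
        vertexVec_apply_self, vertexVec_apply_of_ne hab]
    · by_cases hvb : v = b
      · subst hvb
        simp only [vertexSpace_add_apply, vertexSpace_smul_apply, vertexSpace_sub_apply,
          vertexVec_apply_self, vertexVec_apply_of_ne hva]
        linarith
      · simpa [vertexSpace_add_apply, vertexSpace_smul_apply, vertexSpace_sub_apply,
          vertexVec_apply_of_ne hva, vertexVec_apply_of_ne hvb] using h1
  · have hva : v ≠ a := fun h => hv (h ▸ ha)
    have hvb : v ≠ b := fun h => hv (h ▸ hb)
    simp [vertexSpace_add_apply, vertexSpace_smul_apply, vertexSpace_sub_apply,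
      vertexVec_apply_of_ne hva, vertexVec_apply_of_ne hvb, hσ v hv]
  · have key : ∀ c ∈ σ, ∑ v ∈ σ, vertexVec c v = 1 := fun c hc =>
      (mem_geomSimplex_iff.1 (vertexVec_mem_geomSimplex hc)).2.2
    simp only [vertexSpace_add_apply, vertexSpace_smul_apply, vertexSpace_sub_apply,
      Finset.sum_add_distrib, ← Finset.mul_sum,
      Finset.sum_sub_distrib, h1, key a ha, key b hb]
    ring

theorem edge_mem_faces {X : AbstractSimplicialComplex V} {σ : Finset V} (hσ : σ ∈ X.faces)
    {a b : V} (ha : a ∈ σ) (hb : b ∈ σ) [DecidableEq V] : ({a, b} : Finset V) ∈ X.faces := by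
  refine X.isRelLowerSet_faces.mem_of_le hσ ?_ (by simp)
  · intro v hv
    simp only [Finset.mem_insert, Finset.mem_singleton] at hv
    rcases hv with rfl | rfl <;> assumption

theorem norm_edge_sq {a b : V} (hab : a ≠ b) : ‖vertexVec b - vertexVec a‖ ^ 2 = 2 := by
  classical
  have h1 : ∀ v : V, ‖vertexVec v‖ = 1 := fun v => by simp [vertexVec]
  have h2 : inner ℝ (vertexVec b) (vertexVec a) = 0 := by
    rw [vertexVec, lp.inner_single_left]
    simp [vertexVec_apply_of_ne hab.symm]
  rw [norm_sub_sq_real, h1, h1, h2]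
  norm_num

end SimplexGeometry

/-! ### Colouring the vertices -/

section Colouring

variable {V : Type*}

/-- Greedy colouring: if every vertex has at most `k` neighbours, the colours `0, …, k` suffice to
give adjacent vertices distinct colours. -/
theorem exists_colouring [Finite V] (X : AbstractSimplicialComplex V) (k : ℕ)
    (hX : ∀ u, (vertexNeighbors X u).encard ≤ k) :
    ∃ f : V → ℕ, (∀ v, f v ≤ k) ∧ ∀ u w, w ∈ vertexNeighbors X u → f u ≠ f w := by
  classical
  have symm : ∀ u w, w ∈ vertexNeighbors X u → u ∈ vertexNeighbors X w := by
    rintro u w ⟨h1, h2⟩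
    exact ⟨h1.symm, by rwa [Finset.pair_comm]⟩
  have : Fintype V := Fintype.ofFinite V
  suffices h : ∀ S : Finset V, ∃ f : V → ℕ, (∀ v, f v ≤ k) ∧
      ∀ u ∈ S, ∀ w ∈ S, w ∈ vertexNeighbors X u → f u ≠ f w by
    obtain ⟨f, hf, h⟩ := h Finset.univ
    exact ⟨f, hf, fun u w => h u (Finset.mem_univ _) w (Finset.mem_univ _)⟩
  intro S
  induction S using Finset.induction_on with
  | empty => exact ⟨fun _ => 0, fun _ => Nat.zero_le _, by simp⟩
  | insert a S ha ih =>
    obtain ⟨f, hf, h⟩ := ih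
    obtain ⟨c, hc, hcf⟩ : ∃ c ∈ Finset.range (k + 1),
        c ∉ ((vertexNeighbors X a).toFinset.image f) := by
      refine Finset.exists_mem_notMem_of_card_lt_card ?_
      refine lt_of_le_of_lt Finset.card_image_le ?_
      have := hX a
      rw [Set.encard_eq_coe_toFinset_card] at this
      rw [Finset.card_range]
      exact Nat.lt_succ_of_le (by exact_mod_cast this)
    have hcf' : ∀ w ∈ vertexNeighbors X a, f w ≠ c := fun w hw e =>
      hcf (Finset.mem_image.2 ⟨w, by simpa using hw, e⟩)
    refine ⟨Function.update f a c, fun v => ?_, ?_⟩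
    · by_cases hv : v = a
      · subst hv; simpa [Nat.lt_succ_iff] using hc
      · simpa [hv] using hf v
    · intro u hu w hw huw
      by_cases hua : u = a
      · subst hua
        have hwu : w ≠ u := huw.1
        simpa [hwu] using (hcf' w huw).symm
      · by_cases hwa : w = a
        · subst hwa
          simpa [hua] using hcf' u (symm _ _ huw)
        · simpa [hua, hwa] using h u (Finset.mem_of_mem_insert_of_ne hu hua) w
            (Finset.mem_of_mem_insert_of_ne hw hwa) huw

end Colouring

/-! ### Finiteness of the triangulation -/

section Finiteness

variable {V : Type*} {n : ℕ} {N : Type*} [TopologicalSpace N]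
  [ChartedSpace (EuclideanSpace ℝ (Fin n)) N]

/-- The vertices are a discrete closed subset of the compact space `|X| ≃ N`. -/
theorem finite_vertices [CompactSpace N] {X : AbstractSimplicialComplex V}
    {F : VertexSpace V → N} (hF : IsSmoothTriangulation n X F) : Finite V := by
  have hc : CompactSpace (geomRealization X) := (hF.homeo.homeomorph).symm.compactSpace
  have hK : IsCompact (geomRealization X) := isCompact_iff_compactSpace.2 hc
  have hcl : IsClosed (Set.range (vertexVec : V → VertexSpace V)) := by
    refine Metric.isClosed_of_pairwise_le_dist one_pos ?_
    rintro _ ⟨v, rfl⟩ _ ⟨w, rfl⟩ hvw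
    exact one_le_dist_vertexVec fun h => hvw (by rw [h])
  have hR : IsCompact (Set.range (vertexVec : V → VertexSpace V)) :=
    hK.of_isClosed_subset hcl (by rintro _ ⟨v, rfl⟩; exact vertexVec_mem_geomRealization X v)
  have hD : DiscreteTopology (Set.range (vertexVec : V → VertexSpace V)) := by
    refine DiscreteTopology.of_forall_le_dist one_pos ?_
    rintro ⟨_, v, rfl⟩ ⟨_, w, rfl⟩ hvw
    exact one_le_dist_vertexVec fun h => hvw (by subst h; rfl)
  have hfin := hR.finite ⟨hD⟩
  have := hfin.to_subtype
  exact Finite.of_injective (Set.rangeFactorization vertexVec)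
    (Set.rangeFactorization_injective.2 vertexVec_injective)

end Finiteness


/-! ### Growth along line segments -/

section MonotoneAlongLines

open Filter Topology Metric

variable {W E : Type*} [NormedAddCommGroup W] [NormedSpace ℝ W]
  [NormedAddCommGroup E] [NormedSpace ℝ E]

/-- On a convex set, two derivatives agree on the vectors that point into the set, even if the set
has empty interior. -/
theorem HasFDerivWithinAt.apply_sub_eq_of_convex {f : W → E} {A A' : W →L[ℝ] E} {s : Set W}
    (hs : Convex ℝ s) {x y : W} (hx : x ∈ s) (hy : y ∈ s) (h : HasFDerivWithinAt f A s x)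
    (h' : HasFDerivWithinAt f A' s x) : A (y - x) = A' (y - x) :=
  h.unique_on h' (mem_tangentConeAt_of_segment_subset (hs.segment_subset hx hy))

/-- A `C¹` map on a convex set is strictly differentiable relative to this set. -/
theorem ContDiffWithinAt.exists_norm_sub_sub_le_of_convex {f : W → E} {A : W →L[ℝ] E} {s : Set W}
    (hs : Convex ℝ s) {x : W} (hx : x ∈ s) (hf : ContDiffWithinAt ℝ 1 f s x)
    (h : HasFDerivWithinAt f A s x) {κ : ℝ} (hκ : 0 < κ) :
    ∃ r > 0, ∀ w ∈ s ∩ ball x r, ∀ w' ∈ s ∩ ball x r,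
      ‖f w' - f w - A (w' - w)‖ ≤ κ * ‖w' - w‖ := by
  obtain ⟨u, hu, -, -, f', hf', hc⟩ :=
    (contDiffWithinAt_succ_iff_hasFDerivWithinAt' (n := 0) (by simp)).1 (by simpa using hf)
  have hc' : ContinuousWithinAt f' s x := hc.continuousWithinAt
  rw [Set.insert_eq_of_mem hx] at hu
  have h1 : ∀ᶠ w in 𝓝[s] x, w ∈ u ∧ ‖f' w - f' x‖ ≤ κ := by
    refine Filter.Eventually.and hu ?_
    filter_upwards [hc'.eventually (ball_mem_nhds _ hκ)] with w hw
    rw [dist_eq_norm] at hw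
    exact hw.le
  obtain ⟨r, hr, hball⟩ := Metric.mem_nhdsWithin_iff.1 h1
  refine ⟨r, hr, fun w hw w' hw' => ?_⟩
  have hsub : s ∩ ball x r ⊆ s := Set.inter_subset_left
  have key := Convex.norm_image_sub_le_of_norm_hasFDerivWithin_le' (f := f) (f' := f')
    (φ := f' x) (C := κ) (s := s ∩ ball x r) (x := w) (y := w')
    (fun z hz => (hf' z (hball ⟨hz.2, hz.1⟩).1).mono hsub)
    (fun z hz => (hball ⟨hz.2, hz.1⟩).2) (hs.inter (convex_ball x r)) hw hw'
  have hxu : x ∈ u := (hball ⟨mem_ball_self hr, hx⟩).1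
  have e : A (w' - w) = f' x (w' - w) := by
    have e1 := h.apply_sub_eq_of_convex hs hx hw.1 (hf' x hxu)
    have e2 := h.apply_sub_eq_of_convex hs hx hw'.1 (hf' x hxu)
    have : w' - w = (w' - x) - (w - x) := by abel
    rw [this, map_sub A, map_sub (f' x), e1, e2]
  rw [e]
  exact key

/-- A form of the mean value inequality: local linear growth to the right integrates. -/
theorem add_mul_le_of_eventually_right {u : ℝ → ℝ} {c t : ℝ} (ht : 0 ≤ t)
    (hu : ContinuousOn u (Set.Icc 0 t))
    (h : ∀ s ∈ Set.Ico 0 t, ∀ᶠ s' in 𝓝[>] s, u s + c * (s' - s) ≤ u s') :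
    u 0 + c * t ≤ u t := by
  have hcl : IsClosed ({s | u 0 + c * s ≤ u s} ∩ Set.Icc 0 t) := by
    rw [Set.inter_comm]
    exact isClosed_Icc.isClosed_le (by fun_prop) hu
  refine hcl.Icc_subset_of_forall_mem_nhdsWithin (by simp) ?_ (Set.right_mem_Icc.2 ht)
  rintro s ⟨hs, hst⟩
  filter_upwards [h s hst] with s' hs'
  simp only [Set.mem_ofPred_eq] at hs ⊢
  linarith

/-- Let `G` be `C¹` on the convex set `T` with derivative `A` at `x` that is bounded below on
directions of `T`. If `w, w' ∈ T` near `x` have images differing by `t • Z` with `Z` near `A ξ`,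
then `w' - w` is nearly `t • ξ`, so a linear form `ℓ` with `ℓ ξ ≥ 1` grows at rate almost `1`. -/
theorem exists_linear_growth_on_convex {G : W → E} {T : Set W} (hT : Convex ℝ T) {x : W}
    (hx : x ∈ T) (hG : ContDiffWithinAt ℝ 1 G T x) {A : W →L[ℝ] E}
    (hA : HasFDerivWithinAt G A T x) {m : ℝ} (hm : 0 < m)
    (hmA : ∀ u ∈ vectorSpan ℝ T, m * ‖u‖ ≤ ‖A u‖) {ξ : W} (hξ : ξ ∈ vectorSpan ℝ T)
    (ℓ : W →L[ℝ] ℝ) (hℓ : 1 ≤ ℓ ξ) :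
    ∃ r > 0, ∀ w ∈ T ∩ ball x r, ∀ w' ∈ T ∩ ball x r, ∀ t : ℝ, 0 ≤ t → ∀ Z : E,
      ‖Z - A ξ‖ < r → G w' - G w = t • Z → 3 / 4 * t ≤ ℓ (w' - w) := by
  set η : ℝ := 1 / (4 * (‖ℓ‖ + 1)) with hη
  have hℓ0 : 0 ≤ ‖ℓ‖ := norm_nonneg _
  have hη0 : 0 < η := by positivity
  have hZ0 : 0 ≤ ‖A ξ‖ := norm_nonneg _
  -- the errors `κ ‖w' - w‖` and `t ‖Z - A ξ‖` contribute at most `m η t / 2` each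
  set κ : ℝ := min (m / 2) (m ^ 2 * η / (4 * (‖A ξ‖ + 1))) with hκ
  have hκ0 : 0 < κ := lt_min (by positivity) (by positivity)
  have hκ1 : κ ≤ m / 2 := min_le_left _ _
  have hκ2 : κ * (4 * (‖A ξ‖ + 1)) ≤ m ^ 2 * η := by
    rw [← le_div_iff₀ (by positivity)]
    exact min_le_right _ _
  obtain ⟨r, hr, hstrict⟩ := hG.exists_norm_sub_sub_le_of_convex hT hx hA hκ0
  refine ⟨min r (min 1 (m * η / 2)), lt_min hr (lt_min one_pos (by positivity)), ?_⟩
  rintro w ⟨hwT, hw⟩ w' ⟨hw'T, hw'⟩ t ht Z hZ hGZ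
  have hZ1 : ‖Z - A ξ‖ ≤ 1 := hZ.le.trans ((min_le_right _ _).trans (min_le_left _ _))
  have hZ2 : ‖Z - A ξ‖ ≤ m * η / 2 := hZ.le.trans ((min_le_right _ _).trans (min_le_right _ _))
  have hs := hstrict w ⟨hwT, ball_subset_ball (min_le_left _ _) hw⟩ w'
    ⟨hw'T, ball_subset_ball (min_le_left _ _) hw'⟩
  rw [hGZ] at hs
  set D := w' - w with hDdef
  have hD : D ∈ vectorSpan ℝ T := vsub_mem_vectorSpan ℝ hw'T hwT
  have h1 : m * ‖D‖ ≤ t * (‖A ξ‖ + 1) + κ * ‖D‖ := by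
    have hZn : ‖Z‖ ≤ ‖A ξ‖ + 1 := by
      have := norm_add_le (Z - A ξ) (A ξ)
      rw [sub_add_cancel] at this
      linarith
    have h2 : ‖A D‖ ≤ ‖t • Z‖ + ‖t • Z - A D‖ := by
      have := norm_sub_le (t • Z) (t • Z - A D)
      rwa [sub_sub_cancel] at this
    rw [norm_smul, Real.norm_of_nonneg ht] at h2
    have h3 := mul_le_mul_of_nonneg_left hZn ht
    have h4 := hmA D hD
    linarith
  have hD0 : 0 ≤ ‖D‖ := norm_nonneg _
  have h2 : m * ‖D‖ ≤ 2 * (t * (‖A ξ‖ + 1)) := by nlinarith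
  have h3 : κ * ‖D‖ ≤ m * η / 2 * t := by
    have : m * (κ * ‖D‖) ≤ m * (m * η / 2 * t) := by
      calc m * (κ * ‖D‖) = κ * (m * ‖D‖) := by ring
        _ ≤ κ * (2 * (t * (‖A ξ‖ + 1))) := by gcongr
        _ = κ * (4 * (‖A ξ‖ + 1)) * (t / 2) := by ring
        _ ≤ m ^ 2 * η * (t / 2) := by gcongr
        _ = m * (m * η / 2 * t) := by ring
    exact le_of_mul_le_mul_left this hm
  have h4 : m * ‖D - t • ξ‖ ≤ m * (η * t) := by
    have e : A (D - t • ξ) = t • (Z - A ξ) - (t • Z - A D) := by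
      rw [map_sub, map_smul, smul_sub]; abel
    have h5 := hmA (D - t • ξ) (Submodule.sub_mem _ hD (Submodule.smul_mem _ t hξ))
    have h6 : ‖A (D - t • ξ)‖ ≤ t * ‖Z - A ξ‖ + ‖t • Z - A D‖ := by
      rw [e]
      refine (norm_sub_le _ _).trans ?_
      rw [norm_smul, Real.norm_of_nonneg ht]
    have h7 := mul_le_mul_of_nonneg_left hZ2 ht
    linarith
  have h5 : ‖D - t • ξ‖ ≤ η * t := le_of_mul_le_mul_left h4 hm
  have h6 : ℓ D = t * ℓ ξ + ℓ (D - t • ξ) := by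
    have : D = t • ξ + (D - t • ξ) := by abel
    conv_lhs => rw [this, map_add, map_smul, smul_eq_mul]
  have h7 : -(‖ℓ‖ * (η * t)) ≤ ℓ (D - t • ξ) := by
    have := (ℓ.le_opNorm (D - t • ξ)).trans (mul_le_mul_of_nonneg_left h5 hℓ0)
    rw [Real.norm_eq_abs] at this
    exact (abs_le.1 this).1
  have h8 : ‖ℓ‖ * η ≤ 1 / 4 := by
    rw [hη, mul_one_div, div_le_div_iff₀ (by positivity) (by norm_num)]
    linarith
  have h9 := mul_le_mul_of_nonneg_right h8 ht
  have h10 := mul_le_mul_of_nonneg_left hℓ ht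
  rw [h6]
  linarith

/-- Local growth on each member of a finite closed cover of the range of the inverse `Y` of `G`
gives growth of `ℓ ∘ Y` along all line segments near `y₀` with direction near `Z₀`. A segment may
pass between the members of the cover infinitely often; a short initial piece of it only meets
members that contain its starting point. -/
theorem exists_growth_along_lines {J : Type*} [Finite J] (T : J → Set W)
    (hT : ∀ j, IsClosed (T j)) {G : W → E} {Y : E → W} {y₀ Z₀ : E} {R : ℝ} (hR : 0 < R)
    (hY : ContinuousOn Y (ball y₀ R)) (hYT : ∀ y ∈ ball y₀ R, ∃ j, Y y ∈ T j)
    (hGY : ∀ y ∈ ball y₀ R, G (Y y) = y) (ℓ : W →L[ℝ] ℝ)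
    (hloc : ∀ j, Y y₀ ∈ T j → ∃ r > 0, ∀ w ∈ T j ∩ ball (Y y₀) r, ∀ w' ∈ T j ∩ ball (Y y₀) r,
      ∀ t : ℝ, 0 ≤ t → ∀ Z : E, ‖Z - Z₀‖ < r → G w' - G w = t • Z → 3 / 4 * t ≤ ℓ (w' - w)) :
    ∃ r > 0, r ≤ R ∧ ∀ y Z : E, ∀ t : ℝ, 0 ≤ t → y ∈ ball y₀ r → y + t • Z ∈ ball y₀ r →
      ‖Z - Z₀‖ < r → ℓ (Y y) + 3 / 4 * t ≤ ℓ (Y (y + t • Z)) := by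
  have hloc' : ∀ j, ∃ r > 0, ∀ w ∈ T j ∩ ball (Y y₀) r, ∀ w' ∈ T j ∩ ball (Y y₀) r,
      ∀ t : ℝ, 0 ≤ t → ∀ Z : E, ‖Z - Z₀‖ < r → G w' - G w = t • Z → 3 / 4 * t ≤ ℓ (w' - w) := by
    intro j
    by_cases hj : Y y₀ ∈ T j
    · exact hloc j hj
    · obtain ⟨r, hr, h⟩ := Metric.isOpen_iff.1 (hT j).isOpen_compl _ hj
      exact ⟨r, hr, fun w hw => absurd hw.1 (h hw.2)⟩
  choose ρ hρ hρT using hloc'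
  obtain ⟨ρ₀, hρ₀, hρ₀j⟩ : ∃ ρ₀ > 0, ∀ j, ρ₀ ≤ ρ j := by
    have h : ∀ᶠ s in 𝓝[>] (0 : ℝ), ∀ j, s ≤ ρ j :=
      Filter.eventually_all.2 fun j => nhdsWithin_le_nhds (eventually_le_nhds (hρ j))
    obtain ⟨s, hs, hs'⟩ := (h.and self_mem_nhdsWithin).exists
    exact ⟨s, hs', hs⟩
  have hYc : ContinuousAt Y y₀ := hY.continuousAt (ball_mem_nhds y₀ hR)
  obtain ⟨r, hr, hrY⟩ := Metric.mem_nhds_iff.1 (hYc.preimage_mem_nhds (ball_mem_nhds _ hρ₀))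
  refine ⟨min R (min r ρ₀), lt_min hR (lt_min hr hρ₀), min_le_left _ _, ?_⟩
  intro y Z t ht hy hyt hZ
  have hseg : ∀ s ∈ Set.Icc 0 t, y + s • Z ∈ ball y₀ (min R (min r ρ₀)) := by
    intro s hs
    rcases ht.eq_or_lt with rfl | ht'
    · obtain rfl : s = 0 := le_antisymm hs.2 hs.1
      simpa using hy
    · have := (convex_ball y₀ (min R (min r ρ₀))).add_smul_mem hy hyt
        (t := s / t) ⟨div_nonneg hs.1 ht, (div_le_one ht').2 hs.2⟩
      rwa [smul_smul, div_mul_cancel₀ _ ht'.ne'] at this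
  have hsegR : ∀ s ∈ Set.Icc 0 t, y + s • Z ∈ ball y₀ R := fun s hs =>
    ball_subset_ball (min_le_left _ _) (hseg s hs)
  have hsegY : ∀ s ∈ Set.Icc 0 t, Y (y + s • Z) ∈ ball (Y y₀) ρ₀ := fun s hs =>
    hrY (ball_subset_ball ((min_le_right _ _).trans (min_le_left _ _)) (hseg s hs))
  have hcont : ContinuousOn (fun s : ℝ => Y (y + s • Z)) (Set.Icc 0 t) :=
    hY.comp (by fun_prop) hsegR
  have key := add_mul_le_of_eventually_right (u := fun s => ℓ (Y (y + s • Z))) (c := 3 / 4) ht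
    (ℓ.continuous.comp_continuousOn hcont) ?_
  · simpa using key
  intro s hs
  have hs' : s ∈ Set.Icc 0 t := ⟨hs.1, hs.2.le⟩
  have hcs : ContinuousAt (fun s : ℝ => Y (y + s • Z)) s :=
    (hY.continuousAt (isOpen_ball.mem_nhds (hsegR s hs'))).comp (f := fun s : ℝ => y + s • Z)
      (by fun_prop)
  have hev : ∀ᶠ s' in 𝓝[>] s, ∀ j, Y (y + s' • Z) ∈ T j → Y (y + s • Z) ∈ T j := by
    refine nhdsWithin_le_nhds (Filter.eventually_all.2 fun j => ?_)
    by_cases hj : Y (y + s • Z) ∈ T j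
    · exact Filter.Eventually.of_forall fun _ _ => hj
    · filter_upwards [hcs.preimage_mem_nhds ((hT j).isOpen_compl.mem_nhds hj)] with s' h h'
      exact absurd h' h
  filter_upwards [hev, Ioc_mem_nhdsGT hs.2] with s' h hs1
  have hs1' : s' ∈ Set.Icc 0 t := ⟨hs.1.trans hs1.1.le, hs1.2⟩
  obtain ⟨j, hj⟩ := hYT _ (hsegR s' hs1')
  have := hρT j _ ⟨h j hj, ball_subset_ball (hρ₀j j) (hsegY s hs')⟩ _
    ⟨hj, ball_subset_ball (hρ₀j j) (hsegY s' hs1')⟩ (s' - s) (sub_nonneg.2 hs1.1.le) Z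
    (hZ.trans_le (((min_le_right _ _).trans (min_le_right _ _)).trans (hρ₀j j)))
    (by rw [hGY _ (hsegR s hs'), hGY _ (hsegR s' hs1'), sub_smul]; abel)
  rw [map_sub] at this
  linarith

end MonotoneAlongLines

/-! ### Mollification -/

section Mollification

open MeasureTheory Metric

variable {E : Type*} [NormedAddCommGroup E] [InnerProductSpace ℝ E] [FiniteDimensional ℝ E]
  [MeasurableSpace E] [BorelSpace E]

/-- The convolution of `g` with the normalized bump function `b`. -/
def mollify (b : ContDiffBump (0 : E)) (g : E → ℝ) : E → ℝ :=
  convolution (b.normed volume) g (ContinuousLinearMap.lsmul ℝ ℝ) volume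

theorem contDiff_mollify (b : ContDiffBump (0 : E)) {g : E → ℝ} (hg : LocallyIntegrable g) :
    ContDiff ℝ ∞ (mollify b g) :=
  b.hasCompactSupport_normed.contDiff_convolution_left _ b.contDiff_normed hg

theorem abs_mollify_sub_le (b : ContDiffBump (0 : E)) {g : E → ℝ} (hg : LocallyIntegrable g)
    {y : E} {κ : ℝ} (h : ∀ z ∈ ball y b.rOut, |g z - g y| ≤ κ) : |mollify b g y - g y| ≤ κ :=
  ContDiffBump.dist_normed_convolution_le hg.aestronglyMeasurable h

/-- Mollification keeps lower bounds for increments. -/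
theorem le_mollify_sub (b : ContDiffBump (0 : E)) {g : E → ℝ} (hg : LocallyIntegrable g)
    {y y' : E} {c : ℝ} (h : ∀ z ∈ ball (0 : E) b.rOut, c ≤ g (y' - z) - g (y - z)) :
    c ≤ mollify b g y' - mollify b g y := by
  have hex := b.hasCompactSupport_normed.convolutionExists_left (μ := volume)
    (ContinuousLinearMap.lsmul ℝ ℝ) (b.continuous_normed (μ := volume)) hg
  have h1 : ∀ w, mollify b g w = ∫ z, b.normed volume z * g (w - z) := fun w => rfl
  have hi : ∀ w, Integrable (fun z => b.normed volume z * g (w - z)) := fun w => hex w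
  rw [h1, h1, ← integral_sub (hi y') (hi y)]
  have h2 : c = ∫ z, b.normed volume z * c := by
    rw [integral_mul_const, b.integral_normed, one_mul]
  rw [h2]
  refine integral_mono (b.integrable_normed.mul_const c) ((hi y').sub (hi y)) fun z => ?_
  simp only [← mul_sub]
  by_cases hz : z ∈ ball (0 : E) b.rOut
  · exact mul_le_mul_of_nonneg_left (h z hz) (b.nonneg_normed z)
  · have : b.normed volume z = 0 := by
      rw [← Function.notMem_support, b.support_normed_eq]
      exact hz
    simp [this]

end Mollification


/-! ### Coordinates of tangent vectors -/

section ChartCalculus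

open Filter Topology Metric

variable {n : ℕ} {N : Type*} [TopologicalSpace N] [ChartedSpace (EuclideanSpace ℝ (Fin n)) N]

/-- The components of the tangent vector `Z` in the chart at `q`. -/
def chartVector (q : N) {p : N} (Z : TangentSpace (𝓡 n) p) : EuclideanSpace ℝ (Fin n) :=
  mfderiv (𝓡 n) 𝓘(ℝ, EuclideanSpace ℝ (Fin n)) (extChartAt (𝓡 n) q) p Z

theorem extChartAt_source_eq (q : N) :
    (extChartAt (𝓡 n) q).source = (chartAt (EuclideanSpace ℝ (Fin n)) q).source := by
  simp

variable [IsManifold (𝓡 n) ∞ N]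

theorem contMDiffAt_extChartAt_symm (q : N) {y : EuclideanSpace ℝ (Fin n)}
    (hy : y ∈ (extChartAt (𝓡 n) q).target) :
    ContMDiffAt 𝓘(ℝ, EuclideanSpace ℝ (Fin n)) (𝓡 n) ∞ (extChartAt (𝓡 n) q).symm y :=
  (contMDiffOn_extChartAt_symm q).contMDiffAt ((isOpen_extChartAt_target q).mem_nhds hy)

theorem contMDiffAt_extChartAt_of_mem {q p : N} (hp : p ∈ (extChartAt (𝓡 n) q).source) :
    ContMDiffAt (𝓡 n) 𝓘(ℝ, EuclideanSpace ℝ (Fin n)) ∞ (extChartAt (𝓡 n) q) p :=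
  contMDiffAt_extChartAt' (by rwa [extChartAt_source_eq] at hp)

theorem chartVector_self {p : N} (Z : TangentSpace (𝓡 n) p) : chartVector p Z = Z := by
  rw [chartVector, mfderiv_extChartAt_self]
  rfl

/-- A chart read in the chart centred at `p` is strictly differentiable at `p`, and the
derivative transforms the components of tangent vectors. -/
theorem exists_hasStrictFDerivAt_transition {q p : N} (hp : p ∈ (extChartAt (𝓡 n) q).source) :
    ∃ T' : EuclideanSpace ℝ (Fin n) →L[ℝ] EuclideanSpace ℝ (Fin n),
      HasStrictFDerivAt (extChartAt (𝓡 n) q ∘ (extChartAt (𝓡 n) p).symm) T'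
        (extChartAt (𝓡 n) p p) ∧
      ∀ Z : TangentSpace (𝓡 n) p, T' (chartVector p Z) = chartVector q Z := by
  have h1 := contMDiffAt_extChartAt_symm p (mem_extChartAt_target (I := 𝓡 n) p)
  have h2 : ContMDiffAt (𝓡 n) 𝓘(ℝ, EuclideanSpace ℝ (Fin n)) ∞ (extChartAt (𝓡 n) q)
      ((extChartAt (𝓡 n) p).symm (extChartAt (𝓡 n) p p)) := by
    rw [extChartAt_to_inv]
    exact contMDiffAt_extChartAt_of_mem hp
  have h3 := (h2.comp _ h1).contDiffAt
  refine ⟨_, h3.hasStrictFDerivAt (by simp), fun Z => ?_⟩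
  have h4 : HasMFDerivAt (𝓡 n) 𝓘(ℝ, EuclideanSpace ℝ (Fin n)) (extChartAt (𝓡 n) p) p
      (ContinuousLinearMap.id ℝ _) := by
    have := (mdifferentiableAt_extChartAt (I := 𝓡 n)
      (mem_chart_source (EuclideanSpace ℝ (Fin n)) p)).hasMFDerivAt
    rwa [mfderiv_extChartAt_self] at this
  have h5 := (h3.differentiableAt (by simp)).hasFDerivAt.hasMFDerivAt.comp p h4
  have h6 : ((extChartAt (𝓡 n) q ∘ (extChartAt (𝓡 n) p).symm) ∘ extChartAt (𝓡 n) p)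
      =ᶠ[𝓝 p] extChartAt (𝓡 n) q := by
    filter_upwards [extChartAt_source_mem_nhds (I := 𝓡 n) p] with z hz
    rw [Function.comp_apply, Function.comp_apply, (extChartAt (𝓡 n) p).left_inv hz]
  rw [chartVector_self, chartVector, (h5.congr_of_eventuallyEq h6.symm).mfderiv]
  rfl

/-- The squared length of the coordinate vector field with constant components is continuous. -/
theorem continuousAt_metric_coordinate_field (g : SmoothMetric n N) (p : N)
    (Z : EuclideanSpace ℝ (Fin n)) :
    ContinuousAt (fun q => g.inner q
      (mfderiv 𝓘(ℝ, EuclideanSpace ℝ (Fin n)) (𝓡 n) (extChartAt (𝓡 n) p).symm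
        (extChartAt (𝓡 n) p q) Z)
      (mfderiv 𝓘(ℝ, EuclideanSpace ℝ (Fin n)) (𝓡 n) (extChartAt (𝓡 n) p).symm
        (extChartAt (𝓡 n) p q) Z)) p := by
  have hsec : ContMDiffAt (𝓡 n) ((𝓡 n).prod 𝓘(ℝ, EuclideanSpace ℝ (Fin n))) ∞
      (fun q => Bundle.TotalSpace.mk' (EuclideanSpace ℝ (Fin n)) q
        ((trivializationAt (EuclideanSpace ℝ (Fin n)) (TangentSpace (𝓡 n)) p).symmL ℝ q Z)) p := by
    rw [Bundle.contMDiffAt_section]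
    refine (contMDiffAt_const (c := Z)).congr_of_eventuallyEq ?_
    filter_upwards [chart_source_mem_nhds (EuclideanSpace ℝ (Fin n)) p] with q hq
    have hq' : q ∈ (trivializationAt (EuclideanSpace ℝ (Fin n)) (TangentSpace (𝓡 n)) p).baseSet :=
      hq
    rw [Bundle.Trivialization.symmL_apply, Bundle.Trivialization.apply_mk_symm]
    all_goals exact hq'
  have h1 : ContMDiffAt (𝓡 n) ((𝓡 n).prod 𝓘(ℝ)) ∞
      (fun q => Bundle.TotalSpace.mk' ℝ (E := Bundle.Trivial N ℝ) q (g.inner q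
        ((trivializationAt (EuclideanSpace ℝ (Fin n)) (TangentSpace (𝓡 n)) p).symmL ℝ q Z)
        ((trivializationAt (EuclideanSpace ℝ (Fin n)) (TangentSpace (𝓡 n)) p).symmL ℝ q Z))) p := by
    apply ContMDiffAt.clm_bundle_apply₂ (F₁ := EuclideanSpace ℝ (Fin n))
      (F₂ := EuclideanSpace ℝ (Fin n))
    · exact g.contMDiff.contMDiffAt
    · exact hsec
    · exact hsec
  simp only [Bundle.contMDiffAt_totalSpace] at h1
  refine h1.2.continuousAt.congr ?_
  filter_upwards [chart_source_mem_nhds (EuclideanSpace ℝ (Fin n)) p] with q hq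
  rw [TangentBundle.symmL_trivializationAt hq]
  have h2 : ∀ y, mfderivWithin 𝓘(ℝ, EuclideanSpace ℝ (Fin n)) (𝓡 n) (extChartAt (𝓡 n) p).symm
      (Set.range (𝓡 n)) y = mfderiv 𝓘(ℝ, EuclideanSpace ℝ (Fin n)) (𝓡 n)
        (extChartAt (𝓡 n) p).symm y := fun y => by
    rw [ModelWithCorners.range_eq_univ, mfderivWithin_univ]
  rw [h2]
  rfl

/-- The squared length of the constant coordinate field through `Z` tends to that of `Z`. -/
theorem tendsto_metricInChart (g : SmoothMetric n N) {p : N} (Z : TangentSpace (𝓡 n) p) :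
    Filter.Tendsto
      (fun y => metricInChart g.inner p y (chartVector p Z) (chartVector p Z))
      (𝓝 (extChartAt (𝓡 n) p p)) (𝓝 (g.inner p Z Z)) := by
  rw [chartVector_self]
  have h1 := (continuousAt_metric_coordinate_field g p Z).tendsto
  have h2 : mfderiv 𝓘(ℝ, EuclideanSpace ℝ (Fin n)) (𝓡 n) (extChartAt (𝓡 n) p).symm
      (extChartAt (𝓡 n) p p) = ContinuousLinearMap.id ℝ _ := by
    have := mfderivWithin_range_extChartAt_symm (I := 𝓡 n) (x := p)
    rwa [ModelWithCorners.range_eq_univ, mfderivWithin_univ] at this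
  rw [h2] at h1
  have h3 : Filter.Tendsto (extChartAt (𝓡 n) p).symm (𝓝 (extChartAt (𝓡 n) p p)) (𝓝 p) := by
    have := (continuousAt_extChartAt_symm (I := 𝓡 n) p).tendsto
    rwa [extChartAt_to_inv] at this
  refine (h1.comp h3).congr' ?_
  filter_upwards [extChartAt_target_mem_nhds (I := 𝓡 n) p] with y hy
  have h4 : ∀ y', y' = y → g.inner ((extChartAt (𝓡 n) p).symm y)
      (mfderiv 𝓘(ℝ, EuclideanSpace ℝ (Fin n)) (𝓡 n) (extChartAt (𝓡 n) p).symm y' Z)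
      (mfderiv 𝓘(ℝ, EuclideanSpace ℝ (Fin n)) (𝓡 n) (extChartAt (𝓡 n) p).symm y' Z)
      = metricInChart g.inner p y Z Z := by
    rintro _ rfl
    rfl
  exact h4 _ ((extChartAt (𝓡 n) p).right_inv hy)

omit [IsManifold (𝓡 n) ∞ N] in
/-- The inclusion of an open subset is the identity in charts. -/
theorem inclusionDeriv_eq_id (U : Opens N) (x : U) :
    inclusionDeriv n U x = ContinuousLinearMap.id ℝ (EuclideanSpace ℝ (Fin n)) := by
  have e : writtenInExtChartAt (𝓡 n) (𝓡 n) x (Subtype.val : U → N)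
      =ᶠ[𝓝 (extChartAt (𝓡 n) x x)] id := by
    have h1 := TopologicalSpace.Opens.chartAt_subtype_val_symm_eventuallyEq
      (H := EuclideanSpace ℝ (Fin n)) U (x := x)
    have h2 := (chartAt (EuclideanSpace ℝ (Fin n)) (x : N)).open_target.mem_nhds
      (mem_chart_target (EuclideanSpace ℝ (Fin n)) (x : N))
    filter_upwards [h1, h2] with y hy hy'
    have h3 : ((chartAt (EuclideanSpace ℝ (Fin n)) x).symm y : N)
        = (chartAt (EuclideanSpace ℝ (Fin n)) (x : N)).symm y := hy.symm
    simp only [writtenInExtChartAt, extChartAt, mfld_simps]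
    rw [h3, OpenPartialHomeomorph.right_inv _ hy']
  have h : HasMFDerivAt (𝓡 n) (𝓡 n) (Subtype.val : U → N) x
      (ContinuousLinearMap.id ℝ (EuclideanSpace ℝ (Fin n))) :=
    ⟨continuous_subtype_val.continuousAt,
      ((hasFDerivAt_id _).congr_of_eventuallyEq e).hasFDerivWithinAt⟩
  exact h.mfderiv

end ChartCalculus


/-! ### Mollification in a chart -/

section Smoothing

open Filter Topology Metric MeasureTheory

variable {n : ℕ} {N : Type*} [TopologicalSpace N] [ChartedSpace (EuclideanSpace ℝ (Fin n)) N]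

/-- The function `φ` read in the chart at `q`, extended by `0` outside the target of the chart. -/
def chartExpr (n : ℕ) {N : Type*} [TopologicalSpace N]
    [ChartedSpace (EuclideanSpace ℝ (Fin n)) N] (φ : N → ℝ) (q : N) :
    EuclideanSpace ℝ (Fin n) → ℝ :=
  (extChartAt (𝓡 n) q).target.indicator (φ ∘ (extChartAt (𝓡 n) q).symm)

theorem chartExpr_of_mem {φ : N → ℝ} {q : N} {y : EuclideanSpace ℝ (Fin n)}
    (hy : y ∈ (extChartAt (𝓡 n) q).target) :
    chartExpr n φ q y = φ ((extChartAt (𝓡 n) q).symm y) :=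
  Set.indicator_of_mem hy _

theorem chartExpr_extChartAt {φ : N → ℝ} {q p : N} (hp : p ∈ (extChartAt (𝓡 n) q).source) :
    chartExpr n φ q (extChartAt (𝓡 n) q p) = φ p := by
  rw [chartExpr_of_mem ((extChartAt (𝓡 n) q).map_source hp), (extChartAt (𝓡 n) q).left_inv hp]

theorem continuousOn_chartExpr {φ : N → ℝ} (hφ : Continuous φ) (q : N) :
    ContinuousOn (chartExpr n φ q) (extChartAt (𝓡 n) q).target :=
  (hφ.comp_continuousOn (continuousOn_extChartAt_symm q)).congr fun _ hy => chartExpr_of_mem hy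

theorem locallyIntegrable_chartExpr {φ : N → ℝ} (hφ : Continuous φ) {B : ℝ}
    (hB : ∀ x, |φ x| ≤ B) (q : N) : LocallyIntegrable (chartExpr n φ q) := by
  have hmeas : AEStronglyMeasurable (chartExpr n φ q) volume := by
    have ho := isOpen_extChartAt_target (I := 𝓡 n) q
    rw [chartExpr, aestronglyMeasurable_indicator_iff ho.measurableSet]
    exact (hφ.comp_continuousOn (continuousOn_extChartAt_symm q)).aestronglyMeasurable
      ho.measurableSet
  refine (locallyIntegrable_const B).mono hmeas (Eventually.of_forall fun y => ?_)
  by_cases hy : y ∈ (extChartAt (𝓡 n) q).target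
  · rw [chartExpr_of_mem hy]
    exact (hB _).trans (le_abs_self B)
  · rw [chartExpr, Set.indicator_of_notMem hy, norm_zero]
    exact norm_nonneg _

/-- The mollification of `φ` in the chart at `q`, as a function on `N`. It is meaningful on the
domain of this chart only. -/
def chartMollify (b : ContDiffBump (0 : EuclideanSpace ℝ (Fin n))) (φ : N → ℝ) (q : N) : N → ℝ :=
  fun x => mollify b (chartExpr n φ q) (extChartAt (𝓡 n) q x)

/-- Mollification in a chart converges uniformly near every point of its domain. -/
theorem eventually_abs_chartMollify_sub_le {φ : N → ℝ} (hφ : Continuous φ) {B : ℝ}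
    (hB : ∀ x, |φ x| ≤ B) {q p : N} (hp : p ∈ (extChartAt (𝓡 n) q).source) {κ : ℝ} (hκ : 0 < κ) :
    ∀ᶠ z : ℝ × N in 𝓝 (0, p), ∀ b : ContDiffBump (0 : EuclideanSpace ℝ (Fin n)), b.rOut ≤ z.1 →
      |chartMollify b φ q z.2 - φ z.2| ≤ κ := by
  have hc : ContinuousAt (chartExpr n φ q) (extChartAt (𝓡 n) q p) :=
    (continuousOn_chartExpr hφ q).continuousAt
      ((isOpen_extChartAt_target q).mem_nhds ((extChartAt (𝓡 n) q).map_source hp))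
  obtain ⟨r, hr, hball⟩ := Metric.continuousAt_iff.1 hc (κ / 2) (half_pos hκ)
  have h1 : ∀ᶠ z : ℝ × N in 𝓝 (0, p), z.1 < r / 2 :=
    continuousAt_fst.eventually (eventually_lt_nhds (half_pos hr))
  have h2 : ∀ᶠ z : ℝ × N in 𝓝 (0, p), z.2 ∈ (extChartAt (𝓡 n) q).source ∧
      extChartAt (𝓡 n) q z.2 ∈ ball (extChartAt (𝓡 n) q p) (r / 2) :=
    (continuousAt_snd (p := ((0 : ℝ), p))).eventually (Filter.Eventually.and
      ((isOpen_extChartAt_source q).mem_nhds hp)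
      ((continuousAt_extChartAt' hp).eventually (ball_mem_nhds _ (half_pos hr))))
  filter_upwards [h1, h2] with z hz1 ⟨hz2, hz3⟩ b hb
  rw [← chartExpr_extChartAt (φ := φ) hz2]
  refine abs_mollify_sub_le b (locallyIntegrable_chartExpr hφ hB q) fun y hy => ?_
  rw [mem_ball] at hz3 hy
  have h3 : dist y (extChartAt (𝓡 n) q p) < r := by
    have := dist_triangle y (extChartAt (𝓡 n) q z.2) (extChartAt (𝓡 n) q p)
    linarith
  have h4 := hball h3
  have h5 := hball (hz3.trans (half_lt_self hr))
  have h6 := dist_triangle_right (chartExpr n φ q y) (chartExpr n φ q (extChartAt (𝓡 n) q z.2))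
    (chartExpr n φ q (extChartAt (𝓡 n) q p))
  rw [Real.dist_eq (chartExpr n φ q y) (chartExpr n φ q (extChartAt (𝓡 n) q z.2))] at h6
  linarith

/-- Near `p` the function `φ` grows at rate at least `3/4` in the direction of the tangent vector
`Z`. In each chart around `p`, the growth is required along all short segments whose direction is
close to the coordinate expression of `Z`; this makes the condition stable under changes of chart,
without any differentiability of `φ`. -/
def GrowsAlong (n : ℕ) {N : Type*} [TopologicalSpace N]
    [ChartedSpace (EuclideanSpace ℝ (Fin n)) N] (φ : N → ℝ) (p : N)
    (Z : TangentSpace (𝓡 n) p) : Prop :=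
  ∀ q : N, p ∈ (extChartAt (𝓡 n) q).source →
    ∃ r > 0, ball (extChartAt (𝓡 n) q p) r ⊆ (extChartAt (𝓡 n) q).target ∧
      ∀ y Z' : EuclideanSpace ℝ (Fin n), ∀ t : ℝ, 0 ≤ t →
        y ∈ ball (extChartAt (𝓡 n) q p) r → y + t • Z' ∈ ball (extChartAt (𝓡 n) q p) r →
        ‖Z' - chartVector q Z‖ < r →
        φ ((extChartAt (𝓡 n) q).symm y) + 3 / 4 * t ≤ φ ((extChartAt (𝓡 n) q).symm (y + t • Z'))

variable [IsManifold (𝓡 n) ∞ N]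

theorem contMDiffAt_chartMollify (b : ContDiffBump (0 : EuclideanSpace ℝ (Fin n))) {φ : N → ℝ}
    (hφ : Continuous φ) {B : ℝ} (hB : ∀ x, |φ x| ≤ B) {q p : N}
    (hp : p ∈ (extChartAt (𝓡 n) q).source) :
    ContMDiffAt (𝓡 n) 𝓘(ℝ, ℝ) ∞ (chartMollify b φ q) p :=
  (contDiff_mollify b (locallyIntegrable_chartExpr hφ hB q)).contMDiff.contMDiffAt.comp p
    (contMDiffAt_extChartAt_of_mem hp)

omit [IsManifold (𝓡 n) ∞ N] in
theorem tendsto_add_smul_segment (p : N) (Z : EuclideanSpace ℝ (Fin n)) :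
    Tendsto (fun z : EuclideanSpace ℝ (Fin n) × ℝ => z.1 + z.2 • Z)
      (𝓝 (extChartAt (𝓡 n) p p) ×ˢ 𝓝[>] 0) (𝓝 (extChartAt (𝓡 n) p p)) := by
  have h : ContinuousAt (fun z : EuclideanSpace ℝ (Fin n) × ℝ => z.1 + z.2 • Z)
      (extChartAt (𝓡 n) p p, 0) := by fun_prop
  have h' : Tendsto (fun z : EuclideanSpace ℝ (Fin n) × ℝ => z.1 + z.2 • Z)
      (𝓝 (extChartAt (𝓡 n) p p) ×ˢ 𝓝 0) (𝓝 (extChartAt (𝓡 n) p p)) := by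
    rw [← nhds_prod_eq]
    simpa [ContinuousAt] using h
  exact h'.mono_left (Filter.prod_mono_right _ nhdsWithin_le_nhds)

/-- If `φ` grows along `Z` at `p`, its mollifications in any chart grow along the segments in
direction `Z` in the chart centred at `p`. -/
theorem GrowsAlong.eventually_chartMollify {φ : N → ℝ} (hφ : Continuous φ) {B : ℝ}
    (hB : ∀ x, |φ x| ≤ B) {p : N} {Z : TangentSpace (𝓡 n) p} (hZ : GrowsAlong n φ p Z) {q : N}
    (hp : p ∈ (extChartAt (𝓡 n) q).source) :
    ∀ᶠ z : ℝ × EuclideanSpace ℝ (Fin n) × ℝ in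
      𝓝 0 ×ˢ 𝓝 (extChartAt (𝓡 n) p p) ×ˢ 𝓝[>] (0 : ℝ),
      ∀ b : ContDiffBump (0 : EuclideanSpace ℝ (Fin n)), b.rOut ≤ z.1 →
        3 / 4 * z.2.2 ≤
          chartMollify b φ q ((extChartAt (𝓡 n) p).symm (z.2.1 + z.2.2 • chartVector p Z))
          - chartMollify b φ q ((extChartAt (𝓡 n) p).symm z.2.1) := by
  obtain ⟨r, hr, hrt, hgrow⟩ := hZ q hp
  obtain ⟨T', hT', hT'Z⟩ := exists_hasStrictFDerivAt_transition hp
  have hZq := hT'Z Z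
  rw [← hZq] at hgrow
  set Z₀ : EuclideanSpace ℝ (Fin n) := chartVector p Z with hZ₀
  set y₀ := extChartAt (𝓡 n) p p with hy₀
  set T := extChartAt (𝓡 n) q ∘ (extChartAt (𝓡 n) p).symm with hT
  have hTy₀ : T y₀ = extChartAt (𝓡 n) q p := by
    rw [hT, Function.comp_apply, hy₀, extChartAt_to_inv]
  have hε : 0 < r / (2 * (‖Z₀‖ + 1)) := by positivity
  have hstr := hT'.isLittleO.def hε
  have hseg := tendsto_add_smul_segment p Z₀
  have hpair : Tendsto (fun z : EuclideanSpace ℝ (Fin n) × ℝ => (z.1 + z.2 • Z₀, z.1))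
      (𝓝 y₀ ×ˢ 𝓝[>] 0) (𝓝 (y₀, y₀)) := by
    rw [nhds_prod_eq]
    exact hseg.prodMk tendsto_fst
  have hball : ∀ᶠ y in 𝓝 y₀, T y ∈ ball (extChartAt (𝓡 n) q p) (r / 2) := by
    have := hT'.continuousAt.eventually (ball_mem_nhds _ (half_pos hr))
    rwa [hTy₀] at this
  have h1 : ∀ᶠ z : EuclideanSpace ℝ (Fin n) × ℝ in 𝓝 y₀ ×ˢ 𝓝[>] 0,
      0 < z.2 ∧ T z.1 ∈ ball (extChartAt (𝓡 n) q p) (r / 2) ∧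
      T (z.1 + z.2 • Z₀) ∈ ball (extChartAt (𝓡 n) q p) (r / 2) ∧
      ‖T (z.1 + z.2 • Z₀) - T z.1 - T' (z.1 + z.2 • Z₀ - z.1)‖
        ≤ r / (2 * (‖Z₀‖ + 1)) * ‖z.1 + z.2 • Z₀ - z.1‖ :=
    (tendsto_snd.eventually self_mem_nhdsWithin).and <|
      (tendsto_fst.eventually hball).and <| (hseg.eventually hball).and (hpair.eventually hstr)
  have h0 : ∀ᶠ δ : ℝ in 𝓝 0, δ < r / 2 := eventually_lt_nhds (half_pos hr)
  filter_upwards [h0.prod_mk h1] with ⟨δ, y, t⟩ ⟨hδ, ht, hy, hyt, hs⟩ b hb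
  simp only at hδ ht hy hyt hs hb ⊢
  -- the direction of the segment in the chart at `q`
  set Z' : EuclideanSpace ℝ (Fin n) := t⁻¹ • (T (y + t • Z₀) - T y) with hZ'
  have hTZ' : T (y + t • Z₀) = T y + t • Z' := by
    rw [hZ', smul_smul, mul_inv_cancel₀ ht.ne', one_smul]; abel
  have hZ'r : ‖Z' - T' Z₀‖ < r := by
    have e : Z' - T' Z₀ = t⁻¹ • (T (y + t • Z₀) - T y - T' (y + t • Z₀ - y)) := by
      rw [add_sub_cancel_left, map_smul, smul_sub t⁻¹ _ (t • T' Z₀), smul_smul,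
        inv_mul_cancel₀ ht.ne', one_smul]
    rw [e, norm_smul, norm_inv, Real.norm_of_nonneg ht.le, inv_mul_lt_iff₀ ht]
    rw [add_sub_cancel_left, norm_smul, Real.norm_of_nonneg ht.le] at hs
    rw [add_sub_cancel_left]
    refine hs.trans_lt ?_
    have h3 : ‖Z₀‖ < 2 * (‖Z₀‖ + 1) := by
      have := norm_nonneg Z₀
      linarith
    calc r / (2 * (‖Z₀‖ + 1)) * (t * ‖Z₀‖) = t * r * (‖Z₀‖ / (2 * (‖Z₀‖ + 1))) := by ring
      _ < t * r * 1 := by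
          refine mul_lt_mul_of_pos_left ?_ (mul_pos ht hr)
          rwa [div_lt_one (by positivity)]
      _ = t * r := by ring
  refine le_mollify_sub b (locallyIntegrable_chartExpr hφ hB q) fun s hs' => ?_
  have hmem : ∀ y' ∈ ball (extChartAt (𝓡 n) q p) (r / 2),
      y' - s ∈ ball (extChartAt (𝓡 n) q p) r := by
    intro y' hy'
    rw [mem_ball, dist_eq_norm] at hy' hs' ⊢
    rw [sub_zero] at hs'
    have : y' - s - extChartAt (𝓡 n) q p = (y' - extChartAt (𝓡 n) q p) - s := by abel
    rw [this]
    refine (norm_sub_le _ _).trans_lt ?_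
    linarith
  have m1 := hmem _ hy
  have m2 := hmem _ hyt
  have e2 : T (y + t • Z₀) - s = T y - s + t • Z' := by rw [hTZ']; abel
  change _ ≤ chartExpr n φ q (T (y + t • Z₀) - s) - chartExpr n φ q (T y - s)
  rw [chartExpr_of_mem (hrt m1), chartExpr_of_mem (hrt m2), e2]
  rw [e2] at m2
  have := hgrow _ Z' t ht.le m1 m2 hZ'r
  linarith

/-- A smooth function is Lipschitz along the short coordinate segments near `p`. -/
theorem exists_eventually_abs_sub_le {ρ : N → ℝ} (hρ : ContMDiff (𝓡 n) 𝓘(ℝ, ℝ) ∞ ρ) (p : N)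
    (Z : EuclideanSpace ℝ (Fin n)) :
    ∃ L : ℝ, 0 ≤ L ∧ ∀ᶠ z : EuclideanSpace ℝ (Fin n) × ℝ in
      𝓝 (extChartAt (𝓡 n) p p) ×ˢ 𝓝[>] (0 : ℝ),
      |ρ ((extChartAt (𝓡 n) p).symm (z.1 + z.2 • Z)) - ρ ((extChartAt (𝓡 n) p).symm z.1)|
        ≤ L * z.2 := by
  have h1 : ContDiffAt ℝ ∞ (ρ ∘ (extChartAt (𝓡 n) p).symm) (extChartAt (𝓡 n) p p) :=
    (hρ.contMDiffAt.comp _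
      (contMDiffAt_extChartAt_symm p (mem_extChartAt_target (I := 𝓡 n) p))).contDiffAt
  obtain ⟨K, s, hs, hK⟩ := (h1.of_le (m := 1) (by simp)).exists_lipschitzOnWith
  refine ⟨K * ‖Z‖, by positivity, ?_⟩
  filter_upwards [tendsto_fst.eventually hs, (tendsto_add_smul_segment p Z).eventually hs,
    tendsto_snd.eventually self_mem_nhdsWithin] with z hz1 hz2 hz3
  have := hK.dist_le_mul _ hz2 _ hz1
  rw [Real.dist_eq, dist_eq_norm, add_sub_cancel_left, norm_smul,
    Real.norm_of_nonneg (le_of_lt hz3)] at this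
  refine this.trans (le_of_eq ?_)
  ring

end Smoothing


/-! ### Gluing the mollifications -/

section Gluing

open Filter Topology Metric

variable {n : ℕ} {N : Type*} [TopologicalSpace N] [ChartedSpace (EuclideanSpace ℝ (Fin n)) N]

/-- The sum of the mollifications of `φ` in the charts at the points of `I`, weighted by `ρ`. -/
def gluedMollify (I : Finset N) (ρ : N → N → ℝ)
    (b : ContDiffBump (0 : EuclideanSpace ℝ (Fin n))) (φ : N → ℝ) (x : N) : ℝ :=
  ∑ i ∈ I, ρ i x * chartMollify b φ i x

variable [IsManifold (𝓡 n) ∞ N]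

theorem contMDiff_gluedMollify {I : Finset N} {ρ : N → N → ℝ}
    (hρ : ∀ i, ContMDiff (𝓡 n) 𝓘(ℝ, ℝ) ∞ (ρ i))
    (hρs : ∀ i, tsupport (ρ i) ⊆ (extChartAt (𝓡 n) i).source)
    (b : ContDiffBump (0 : EuclideanSpace ℝ (Fin n))) {φ : N → ℝ}
    (hφ : Continuous φ) {B : ℝ} (hB : ∀ x, |φ x| ≤ B) :
    ContMDiff (𝓡 n) 𝓘(ℝ, ℝ) ∞ (gluedMollify I ρ b φ) := by
  refine contMDiff_finsetSum fun i _ => contMDiff_of_tsupport fun x hx => ?_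
  exact (hρ i).contMDiffAt.mul
    (contMDiffAt_chartMollify b hφ hB (hρs i (tsupport_mul_subset_left hx)))

omit [IsManifold (𝓡 n) ∞ N] in
theorem eventually_abs_gluedMollify_sub_le {I : Finset N} {ρ : N → N → ℝ}
    (hρ0 : ∀ i x, 0 ≤ ρ i x) (hρ1 : ∀ x, ∑ i ∈ I, ρ i x = 1)
    (hρs : ∀ i, tsupport (ρ i) ⊆ (extChartAt (𝓡 n) i).source) {φ : N → ℝ}
    (hφ : Continuous φ) {B : ℝ} (hB : ∀ x, |φ x| ≤ B) (p : N) {κ : ℝ} (hκ : 0 < κ) :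
    ∀ᶠ z : ℝ × N in 𝓝 (0, p), ∀ b : ContDiffBump (0 : EuclideanSpace ℝ (Fin n)), b.rOut ≤ z.1 →
      |gluedMollify I ρ b φ z.2 - φ z.2| ≤ κ := by
  have h : ∀ i ∈ I, ∀ᶠ z : ℝ × N in 𝓝 (0, p),
      ∀ b : ContDiffBump (0 : EuclideanSpace ℝ (Fin n)), b.rOut ≤ z.1 →
      |ρ i z.2 * (chartMollify b φ i z.2 - φ z.2)| ≤ ρ i z.2 * κ := by
    intro i _
    by_cases hp : p ∈ tsupport (ρ i)
    · filter_upwards [eventually_abs_chartMollify_sub_le hφ hB (hρs i hp) hκ] with z hz b hb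
      rw [abs_mul, abs_of_nonneg (hρ0 i _)]
      exact mul_le_mul_of_nonneg_left (hz b hb) (hρ0 i _)
    · have h1 := (continuousAt_snd (p := ((0 : ℝ), p))).eventually
        ((isClosed_tsupport (ρ i)).isOpen_compl.mem_nhds hp)
      filter_upwards [h1] with z hz b _
      rw [image_eq_zero_of_notMem_tsupport hz]
      simp
  filter_upwards [(Filter.eventually_all_finset I).2 h] with z hz b hb
  have e : gluedMollify I ρ b φ z.2 - φ z.2
      = ∑ i ∈ I, ρ i z.2 * (chartMollify b φ i z.2 - φ z.2) := by
    simp only [mul_sub, Finset.sum_sub_distrib, ← Finset.sum_mul, hρ1, one_mul]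
    rfl
  rw [e]
  refine (Finset.abs_sum_le_sum_abs _ _).trans ?_
  refine (Finset.sum_le_sum fun i hi => hz i hi b hb).trans ?_
  rw [← Finset.sum_mul, hρ1, one_mul]

/-- Growth of `φ` along `Z` passes to the glued mollifications. Along a segment from `x` to `x'`
the increment is
`∑ ρᵢ(x) (ψᵢ(x') - ψᵢ(x)) + ∑ (ρᵢ(x') - ρᵢ(x)) (ψᵢ(x') - φ(x'))` for the mollifications `ψᵢ` of `φ`
in the charts; the second sum is small as `ψᵢ` is uniformly close to `φ`. -/
theorem GrowsAlong.eventually_gluedMollify {I : Finset N} {ρ : N → N → ℝ}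
    (hρ : ∀ i, ContMDiff (𝓡 n) 𝓘(ℝ, ℝ) ∞ (ρ i))
    (hρ0 : ∀ i x, 0 ≤ ρ i x) (hρ1 : ∀ x, ∑ i ∈ I, ρ i x = 1)
    (hρs : ∀ i, tsupport (ρ i) ⊆ (extChartAt (𝓡 n) i).source) {φ : N → ℝ}
    (hφ : Continuous φ) {B : ℝ} (hB : ∀ x, |φ x| ≤ B) {p : N} {Z : TangentSpace (𝓡 n) p}
    (hZ : GrowsAlong n φ p Z) :
    ∀ᶠ z : ℝ × EuclideanSpace ℝ (Fin n) × ℝ in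
      𝓝 0 ×ˢ 𝓝 (extChartAt (𝓡 n) p p) ×ˢ 𝓝[>] (0 : ℝ),
      ∀ b : ContDiffBump (0 : EuclideanSpace ℝ (Fin n)), b.rOut ≤ z.1 →
        1 / 2 * z.2.2 ≤
          gluedMollify I ρ b φ ((extChartAt (𝓡 n) p).symm (z.2.1 + z.2.2 • chartVector p Z))
          - gluedMollify I ρ b φ ((extChartAt (𝓡 n) p).symm z.2.1) := by
  choose L hL0 hL using fun i => exists_eventually_abs_sub_le (hρ i) p (chartVector p Z)
  have hΛ : 0 ≤ ∑ i ∈ I, L i := Finset.sum_nonneg fun i _ => hL0 i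
  -- with this precision the second sum is at most `t / 4` in absolute value
  set κ : ℝ := 1 / (4 * (∑ i ∈ I, L i + 1)) with hκ
  have hκ0 : 0 < κ := by positivity
  have hsymm : Tendsto (extChartAt (𝓡 n) p).symm (𝓝 (extChartAt (𝓡 n) p p)) (𝓝 p) := by
    have := (continuousAt_extChartAt_symm (I := 𝓡 n) p).tendsto
    rwa [extChartAt_to_inv] at this
  have hstart : Tendsto
      (fun z : ℝ × EuclideanSpace ℝ (Fin n) × ℝ => (extChartAt (𝓡 n) p).symm z.2.1)
      (𝓝 0 ×ˢ 𝓝 (extChartAt (𝓡 n) p p) ×ˢ 𝓝[>] (0 : ℝ)) (𝓝 p) :=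
    hsymm.comp (tendsto_fst.comp tendsto_snd)
  have hend : Tendsto (fun z : ℝ × EuclideanSpace ℝ (Fin n) × ℝ =>
      (extChartAt (𝓡 n) p).symm (z.2.1 + z.2.2 • chartVector p Z))
      (𝓝 0 ×ˢ 𝓝 (extChartAt (𝓡 n) p p) ×ˢ 𝓝[>] (0 : ℝ)) (𝓝 p) :=
    hsymm.comp ((tendsto_add_smul_segment p (chartVector p Z)).comp tendsto_snd)
  have hpair : Tendsto (fun z : ℝ × EuclideanSpace ℝ (Fin n) × ℝ =>
      (z.1, (extChartAt (𝓡 n) p).symm (z.2.1 + z.2.2 • chartVector p Z)))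
      (𝓝 0 ×ˢ 𝓝 (extChartAt (𝓡 n) p p) ×ˢ 𝓝[>] (0 : ℝ)) (𝓝 (0, p)) := by
    rw [nhds_prod_eq]
    exact tendsto_fst.prodMk hend
  have h : ∀ i ∈ I, ∀ᶠ z : ℝ × EuclideanSpace ℝ (Fin n) × ℝ in
      𝓝 0 ×ˢ 𝓝 (extChartAt (𝓡 n) p p) ×ˢ 𝓝[>] (0 : ℝ),
      ∀ b : ContDiffBump (0 : EuclideanSpace ℝ (Fin n)), b.rOut ≤ z.1 →
        ∀ x x' : N, x = (extChartAt (𝓡 n) p).symm z.2.1 →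
        x' = (extChartAt (𝓡 n) p).symm (z.2.1 + z.2.2 • chartVector p Z) →
        ρ i x * (3 / 4 * z.2.2) - L i * κ * z.2.2 ≤
          ρ i x * (chartMollify b φ i x' - chartMollify b φ i x)
          + (ρ i x' - ρ i x) * (chartMollify b φ i x' - φ x') := by
    intro i _
    by_cases hp : p ∈ tsupport (ρ i)
    · filter_upwards [hZ.eventually_chartMollify hφ hB (hρs i hp), tendsto_snd.eventually (hL i),
        hpair.eventually (eventually_abs_chartMollify_sub_le hφ hB (hρs i hp) hκ0)]
        with z hz1 hz2 hz3 b hb x x' hx hx'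
      have a1 := mul_le_mul_of_nonneg_left (hz1 b hb) (hρ0 i x)
      have a2 := hz3 b hb
      rw [← hx, ← hx'] at a1
      simp only [← hx, ← hx'] at hz2 a2
      have a3 : |(ρ i x' - ρ i x) * (chartMollify b φ i x' - φ x')| ≤ L i * z.2.2 * κ := by
        rw [abs_mul]
        exact mul_le_mul hz2 a2 (abs_nonneg _) ((abs_nonneg _).trans hz2)
      have a4 := (abs_le.1 a3).1
      linarith
    -- away from the support of `ρ i`, both sides vanish up to a term of the right sign
    · have hc := (isClosed_tsupport (ρ i)).isOpen_compl.mem_nhds hp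
      filter_upwards [hstart.eventually hc, hend.eventually hc,
        tendsto_snd.eventually (tendsto_snd.eventually self_mem_nhdsWithin)]
        with z hz1 hz2 hz3 b hb x x' hx hx'
      subst hx hx'
      rw [image_eq_zero_of_notMem_tsupport hz1, image_eq_zero_of_notMem_tsupport hz2]
      have a1 : 0 ≤ L i * κ * z.2.2 := mul_nonneg (mul_nonneg (hL0 i) hκ0.le) (le_of_lt hz3)
      linarith
  filter_upwards [(Filter.eventually_all_finset I).2 h,
    tendsto_snd.eventually (tendsto_snd.eventually self_mem_nhdsWithin)] with z hz ht b hb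
  have ht0 : 0 ≤ z.2.2 := le_of_lt ht
  set x := (extChartAt (𝓡 n) p).symm z.2.1 with hx
  set x' := (extChartAt (𝓡 n) p).symm (z.2.1 + z.2.2 • chartVector p Z) with hx'
  have hsum := Finset.sum_le_sum fun i hi => hz i hi b hb x x' rfl rfl
  have e1 : ∑ i ∈ I, (ρ i x * (3 / 4 * z.2.2) - L i * κ * z.2.2)
      = 3 / 4 * z.2.2 - (∑ i ∈ I, L i) * κ * z.2.2 := by
    rw [Finset.sum_sub_distrib, ← Finset.sum_mul, hρ1, one_mul, ← Finset.sum_mul, ← Finset.sum_mul]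
  have e2 : ∑ i ∈ I, (ρ i x * (chartMollify b φ i x' - chartMollify b φ i x)
      + (ρ i x' - ρ i x) * (chartMollify b φ i x' - φ x'))
      = gluedMollify I ρ b φ x' - gluedMollify I ρ b φ x := by
    have e3 : ∀ i, ρ i x * (chartMollify b φ i x' - chartMollify b φ i x)
        + (ρ i x' - ρ i x) * (chartMollify b φ i x' - φ x')
        = ρ i x' * chartMollify b φ i x' - ρ i x * chartMollify b φ i x
          - (ρ i x' * φ x' - ρ i x * φ x') := fun i => by ring
    simp only [e3, Finset.sum_sub_distrib, ← Finset.sum_mul, hρ1, gluedMollify]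
    ring
  rw [e1, e2] at hsum
  have h4 : (∑ i ∈ I, L i) * κ ≤ 1 / 4 := by
    rw [hκ, mul_one_div, div_le_div_iff₀ (by positivity) (by norm_num)]
    linarith
  have h5 := mul_le_mul_of_nonneg_right h4 ht0
  linarith

/-- A directional derivative is bounded below by the growth rate. -/
theorem le_fderiv_of_eventually {E : Type*} [NormedAddCommGroup E] [NormedSpace ℝ E] {k : E → ℝ}
    {y Z : E} {c : ℝ} (hk : DifferentiableAt ℝ k y)
    (h : ∀ᶠ t in 𝓝[>] (0 : ℝ), c * t ≤ k (y + t • Z) - k y) : c ≤ fderiv ℝ k y Z := by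
  have h1 : HasDerivAt (fun t : ℝ => k (y + t • Z)) (fderiv ℝ k y Z) 0 := by
    have h2 : HasDerivAt (fun t : ℝ => y + t • Z) Z 0 := by
      simpa using ((hasDerivAt_id (0 : ℝ)).smul_const Z).const_add y
    have h3 : HasFDerivAt k (fderiv ℝ k y) (y + (0 : ℝ) • Z) := by simpa using hk.hasFDerivAt
    exact h3.comp_hasDerivAt (0 : ℝ) h2
  refine ge_of_tendsto h1.tendsto_slope_zero_right ?_
  filter_upwards [h, self_mem_nhdsWithin] with t ht ht0
  have ht0' : (0 : ℝ) < t := ht0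
  rw [smul_eq_mul, zero_add, zero_smul, add_zero, inv_mul_eq_div, le_div_iff₀ ht0']
  exact ht

/-- A continuous function on a closed manifold that grows, at each point of a compact set `K`, along
some tangent vector of squared length less than `a`, can be approximated by smooth functions whose
differential is at least `1/2` on such vectors over `K`. -/
theorem exists_smooth_approx_of_growsAlong [T2Space N] [CompactSpace N] (g : SmoothMetric n N)
    {φ : N → ℝ} (hφ : Continuous φ) {a : ℝ} {K : Set N} (hK : IsCompact K)
    (hgrow : ∀ p ∈ K, ∃ Z : TangentSpace (𝓡 n) p, GrowsAlong n φ p Z ∧ g.inner p Z Z < a) :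
    ∃ H : N → ℝ, ContMDiff (𝓡 n) 𝓘(ℝ, ℝ) ∞ H ∧ (∀ x, |H x - φ x| ≤ 1) ∧
      ∀ p ∈ K, ∃ v : TangentSpace (𝓡 n) p, g.inner p v v ≤ a ∧ 1 / 2 ≤ differential n H p v := by
  obtain ⟨B, hB⟩ : ∃ B : ℝ, ∀ x, |φ x| ≤ B := by
    obtain ⟨B, hB⟩ := (isCompact_range hφ).isBounded.exists_norm_le
    exact ⟨B, fun x => hB _ ⟨x, rfl⟩⟩
  obtain ⟨f, hf⟩ := SmoothPartitionOfUnity.exists_isSubordinate_chartAt_source (𝓡 n) N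
  have hfin := f.locallyFinite.finite_nonempty_of_compact
  set I : Finset N := hfin.toFinset with hI
  set ρ : N → N → ℝ := fun i x => f i x with hρdef
  have hρ : ∀ i, ContMDiff (𝓡 n) 𝓘(ℝ, ℝ) ∞ (ρ i) := fun i => (f i).contMDiff
  have hρ0 : ∀ i x, 0 ≤ ρ i x := fun i x => f.nonneg i x
  have hρ1 : ∀ x, ∑ i ∈ I, ρ i x = 1 := fun x => by
    refine f.sum_finsupport' x (Set.mem_univ x) fun i hi => ?_
    rw [hI, Set.Finite.mem_toFinset]
    exact ⟨x, (f.mem_finsupport x).1 hi⟩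
  have hρs : ∀ i, tsupport (ρ i) ⊆ (extChartAt (𝓡 n) i).source := fun i => by
    rw [extChartAt_source_eq]
    exact hf i
  have happrox : ∀ᶠ δ in 𝓝 (0 : ℝ), ∀ x ∈ (Set.univ : Set N),
      ∀ b : ContDiffBump (0 : EuclideanSpace ℝ (Fin n)), b.rOut ≤ δ →
      |gluedMollify I ρ b φ x - φ x| ≤ 1 :=
    isCompact_univ.eventually_forall_of_forall_eventually fun p _ =>
      eventually_abs_gluedMollify_sub_le hρ0 hρ1 hρs hφ hB p one_pos
  have hderiv : ∀ᶠ δ in 𝓝 (0 : ℝ), ∀ p ∈ K,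
      ∀ b : ContDiffBump (0 : EuclideanSpace ℝ (Fin n)), b.rOut ≤ δ →
      ∃ v : TangentSpace (𝓡 n) p, g.inner p v v ≤ a ∧
        1 / 2 ≤ differential n (gluedMollify I ρ b φ) p v := by
    refine hK.eventually_forall_of_forall_eventually fun p hp => ?_
    obtain ⟨Z, hZ, hZa⟩ := hgrow p hp
    have h1 := (Filter.tendsto_prodAssoc.eventually
      (hZ.eventually_gluedMollify hρ hρ0 hρ1 hρs hφ hB)).curry
    have h2 : ∀ᶠ y in 𝓝 (extChartAt (𝓡 n) p p), y ∈ (extChartAt (𝓡 n) p).target ∧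
        metricInChart g.inner p y (chartVector p Z) (chartVector p Z) < a :=
      Filter.Eventually.and (extChartAt_target_mem_nhds (I := 𝓡 n) p)
        ((tendsto_metricInChart g Z).eventually (eventually_lt_nhds hZa))
    have h3 : Tendsto (fun z : ℝ × N => (z.1, extChartAt (𝓡 n) p z.2)) (𝓝 (0, p))
        (𝓝 0 ×ˢ 𝓝 (extChartAt (𝓡 n) p p)) := by
      rw [nhds_prod_eq]
      exact tendsto_fst.prodMk ((continuousAt_extChartAt (I := 𝓡 n) p).tendsto.comp tendsto_snd)
    have h4 := (continuousAt_snd (p := ((0 : ℝ), p))).eventually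
      (extChartAt_source_mem_nhds (I := 𝓡 n) p)
    filter_upwards [h3.eventually (h1.and (tendsto_snd.eventually h2)), h4]
      with ⟨δ, x⟩ ⟨hz1, hz2, hz3⟩ hz4 b hb
    simp only at hz1 hz2 hz3 hz4 hb ⊢
    generalize hy : extChartAt (𝓡 n) p x = y at hz1 hz2 hz3
    obtain rfl : x = (extChartAt (𝓡 n) p).symm y := by
      rw [← hy, (extChartAt (𝓡 n) p).left_inv hz4]
    have hH := contMDiff_gluedMollify (I := I) hρ hρs b hφ hB
    have hs := contMDiffAt_extChartAt_symm p hz2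
    have hk := (hH.contMDiffAt.comp y hs).contDiffAt.differentiableAt (by simp)
    refine ⟨mfderiv 𝓘(ℝ, EuclideanSpace ℝ (Fin n)) (𝓡 n) (extChartAt (𝓡 n) p).symm y
      (chartVector p Z), hz3.le, ?_⟩
    have h5 := le_fderiv_of_eventually (Z := chartVector p Z) (c := 1 / 2) hk
      (by filter_upwards [hz1] with t ht using ht b hb)
    rw [← mfderiv_eq_fderiv] at h5
    have h6 := mfderiv_comp_apply y (hH.contMDiffAt.mdifferentiableAt (by simp))
      (hs.mdifferentiableAt (by simp)) (chartVector p Z)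
    exact h5.trans_eq h6
  obtain ⟨δ, ⟨hδ1, hδ2⟩, hδ0⟩ := ((happrox.and hderiv).filter_mono
    (nhdsWithin_le_nhds (s := Set.Ioi 0))).and self_mem_nhdsWithin |>.exists
  have hδ0' : (0 : ℝ) < δ := hδ0
  let b : ContDiffBump (0 : EuclideanSpace ℝ (Fin n)) :=
    ⟨δ / 2, δ, half_pos hδ0', half_lt_self hδ0'⟩
  exact ⟨gluedMollify I ρ b φ, contMDiff_gluedMollify hρ hρs b hφ hB,
    fun x => hδ1 x (Set.mem_univ x) b le_rfl, fun p hp => hδ2 p hp b le_rfl⟩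

end Gluing


/-! ### Growth of simplexwise linear functions -/

section GrowthOfSimplicialFunctions

open Filter Topology Metric

variable {n : ℕ} {N : Type*} [TopologicalSpace N] [ChartedSpace (EuclideanSpace ℝ (Fin n)) N]
  [IsManifold (𝓡 n) ∞ N] {V : Type*} {X : AbstractSimplicialComplex V} {F : VertexSpace V → N}

theorem exists_mul_norm_le_of_injOn_submodule {W E : Type*} [NormedAddCommGroup W]
    [NormedSpace ℝ W] [NormedAddCommGroup E] [NormedSpace ℝ E] (A : W →L[ℝ] E)
    (S : Submodule ℝ W) [FiniteDimensional ℝ S] (h : ∀ u ∈ S, A u = 0 → u = 0) :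
    ∃ m > 0, ∀ u ∈ S, m * ‖u‖ ≤ ‖A u‖ := by
  have hker : ((A : W →ₗ[ℝ] E).domRestrict S).ker = ⊥ := by
    rw [LinearMap.ker_eq_bot']
    exact fun u hu => Subtype.ext (h u u.2 hu)
  obtain ⟨K, hK, hA⟩ := LinearMap.exists_antilipschitzWith _ hker
  have hK' : (0 : ℝ) < K := hK
  refine ⟨(K : ℝ)⁻¹, inv_pos.2 hK', fun u hu => ?_⟩
  rw [inv_mul_le_iff₀ hK']
  exact hA.le_mul_norm (map_zero _) ⟨u, hu⟩

theorem chartVector_injective {q p : N} (hp : p ∈ (extChartAt (𝓡 n) q).source) :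
    Function.Injective (chartVector q : TangentSpace (𝓡 n) p → EuclideanSpace ℝ (Fin n)) :=
  (isInvertible_mfderiv_extChartAt hp).injective

/-- A smooth map on a simplex, read in a chart, together with its derivative. -/
theorem IsSmoothTriangulation.exists_hasFDerivWithinAt (hF : IsSmoothTriangulation n X F)
    {σ : Finset V} (hσ : σ ∈ X.faces) {x : VertexSpace V} (hx : x ∈ geomSimplex σ) {q : N}
    (hq : F x ∈ (extChartAt (𝓡 n) q).source) :
    ContDiffWithinAt ℝ 1 (extChartAt (𝓡 n) q ∘ F) (geomSimplex σ) x ∧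
    ∃ A : VertexSpace V →L[ℝ] EuclideanSpace ℝ (Fin n),
      HasFDerivWithinAt (extChartAt (𝓡 n) q ∘ F) A (geomSimplex σ) x ∧
      ∀ u, A u = chartVector q (simplexDeriv n F σ x u) := by
  have h1 := hF.smooth σ hσ x hx
  have h2 := contMDiffAt_extChartAt_of_mem hq
  refine ⟨((h2.comp_contMDiffWithinAt x h1).contDiffWithinAt).of_le (by simp), ?_⟩
  have h3 := (h1.mdifferentiableWithinAt (by simp)).hasMFDerivWithinAt
  have h4 := (h2.mdifferentiableAt (by simp)).hasMFDerivAt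
  exact ⟨_, (h4.comp_hasMFDerivWithinAt x h3).hasFDerivWithinAt, fun u => rfl⟩

/-- The derivatives of `F` on two simplices through `x` agree along an edge of the carrier of
`x`, as `F` is the same map on a short segment in this direction. -/
theorem IsSmoothTriangulation.simplexDeriv_edge_eq (hF : IsSmoothTriangulation n X F)
    {σ τ : Finset V} (hσ : σ ∈ X.faces) (hτ : τ ∈ X.faces) {x : VertexSpace V}
    (hxσ : x ∈ geomSimplex σ) (hxτ : x ∈ geomSimplex τ) {a b : V} (ha : 0 < x a) (hb : 0 < x b) :
    simplexDeriv n F σ x (vertexVec b - vertexVec a)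
      = simplexDeriv n F τ x (vertexVec b - vertexVec a) := by
  have hp := mem_extChartAt_source (I := 𝓡 n) (F x)
  obtain ⟨-, A, hA, hAσ⟩ := hF.exists_hasFDerivWithinAt hσ hxσ hp
  obtain ⟨-, A', hA', hAτ⟩ := hF.exists_hasFDerivWithinAt hτ hxτ hp
  refine chartVector_injective hp ?_
  rw [← hAσ, ← hAτ]
  set y := x + x a • (vertexVec b - vertexVec a) with hy
  have hyσ : y ∈ geomSimplex σ := add_smul_edge_mem_geomSimplex hxσ
    (mem_of_apply_pos hxσ ha) (mem_of_apply_pos hxσ hb)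
  have hyτ : y ∈ geomSimplex τ := add_smul_edge_mem_geomSimplex hxτ
    (mem_of_apply_pos hxτ ha) (mem_of_apply_pos hxτ hb)
  have h := HasFDerivWithinAt.apply_sub_eq_of_convex (convex_segment x y)
    (left_mem_segment ℝ x y) (right_mem_segment ℝ x y)
    (hA.mono ((convex_geomSimplex σ).segment_subset hxσ hyσ))
    (hA'.mono ((convex_geomSimplex τ).segment_subset hxτ hyτ))
  rw [hy, add_sub_cancel_left, map_smul, map_smul] at h
  exact smul_right_injective _ ha.ne' h

omit [IsManifold (𝓡 n) ∞ N] in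
theorem IsThickTriangulation.eq_zero_of_simplexDeriv_eq_zero {g : TangentForm n N} {c₀ c₁ : ℝ}
    {c₂ : ℕ} {ε : ℝ} (hF : IsThickTriangulation g c₀ c₁ c₂ ε X F) (hc₀ : 0 < c₀) (hε : 0 < ε)
    {σ : Finset V} (hσ : σ ∈ X.faces) {x : VertexSpace V} (hx : x ∈ geomSimplex σ)
    {u : VertexSpace V} (hu : u ∈ vectorSpan ℝ (geomSimplex σ))
    (h : simplexDeriv n F σ x u = 0) : u = 0 := by
  by_contra hne
  have h1 := (hF.thick σ hσ x hx u hu hne).1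
  rw [h, map_zero, Real.sqrt_zero, zero_div] at h1
  have := mul_pos hc₀ hε
  linarith

/-- The linear extension to `ℝ[V]` of a function on the vertices. -/
def vertexFunctional [Fintype V] (f : V → ℝ) : VertexSpace V →L[ℝ] ℝ :=
  innerSL ℝ (∑ v, f v • vertexVec v)

theorem vertexFunctional_apply [Fintype V] (f : V → ℝ) (x : VertexSpace V) :
    vertexFunctional f x = ∑ v, f v * x v := by
  classical
  rw [vertexFunctional, innerSL_apply_apply, sum_inner]
  refine Finset.sum_congr rfl fun v _ => ?_
  rw [real_inner_smul_left, vertexVec, lp.inner_single_left]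
  simp

theorem vertexFunctional_vertexVec [Fintype V] (f : V → ℝ) (v : V) :
    vertexFunctional f (vertexVec v) = f v := by
  rw [vertexFunctional_apply, Finset.sum_eq_single v]
  · rw [vertexVec_apply_self, mul_one]
  · intro w _ hw
    rw [vertexVec_apply_of_ne hw, mul_zero]
  · simp

/-- A linear function on a simplex is bounded by its values at the vertices. -/
theorem vertexFunctional_mem_Icc [Fintype V] {f : V → ℝ} {k : ℝ} (hf : ∀ v, f v ∈ Set.Icc 0 k)
    {σ : Finset V} {x : VertexSpace V} (hx : x ∈ geomSimplex σ) :
    vertexFunctional f x ∈ Set.Icc 0 k := by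
  have : geomSimplex σ ⊆ vertexFunctional f ⁻¹' Set.Icc 0 k := by
    refine convexHull_min ?_ ((convex_Icc 0 k).linear_preimage (vertexFunctional f).toLinearMap)
    rintro _ ⟨v, -, rfl⟩
    rw [Set.mem_preimage, vertexFunctional_vertexVec]
    exact hf v
  exact this hx

/-- The inverse of the triangulation `F : |X| → N`. -/
def triangulationInverse (hF : IsSmoothTriangulation n X F) (p : N) : VertexSpace V :=
  (hF.homeo.homeomorph.symm p : geomRealization X)

omit [IsManifold (𝓡 n) ∞ N] in
theorem continuous_triangulationInverse (hF : IsSmoothTriangulation n X F) :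
    Continuous (triangulationInverse hF) :=
  continuous_subtype_val.comp hF.homeo.homeomorph.symm.continuous

omit [IsManifold (𝓡 n) ∞ N] in
theorem apply_triangulationInverse (hF : IsSmoothTriangulation n X F) (p : N) :
    F (triangulationInverse hF p) = p :=
  hF.homeo.homeomorph.apply_symm_apply p

omit [IsManifold (𝓡 n) ∞ N] in
theorem exists_triangulationInverse_mem (hF : IsSmoothTriangulation n X F) (p : N) :
    ∃ σ ∈ X.faces, triangulationInverse hF p ∈ geomSimplex σ := by
  have h : triangulationInverse hF p ∈ geomRealization X := Subtype.property _
  simpa [geomRealization] using h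

omit [IsManifold (𝓡 n) ∞ N] in
theorem triangulationInverse_apply (hF : IsSmoothTriangulation n X F) {σ : Finset V}
    (hσ : σ ∈ X.faces) {x : VertexSpace V} (hx : x ∈ geomSimplex σ) :
    triangulationInverse hF (F x) = x := by
  have hx' : x ∈ geomRealization X := Set.mem_biUnion hσ hx
  exact congrArg Subtype.val (hF.homeo.homeomorph.symm_apply_apply ⟨x, hx'⟩)

/-- At a point whose carrier contains the vertices `a` and `b` with `f a + 1 ≤ f b`, the simplexwise
linear function with vertex values `f` grows along the image of the edge vector from `a` to
`b`. -/
theorem IsThickTriangulation.growsAlong_edge [Fintype V] {g : TangentForm n N} {c₀ c₁ : ℝ}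
    {c₂ : ℕ} {ε : ℝ} (hF : IsThickTriangulation g c₀ c₁ c₂ ε X F) (hc₀ : 0 < c₀) (hε : 0 < ε)
    {f : V → ℝ} {σ : Finset V} (hσ : σ ∈ X.faces) {x : VertexSpace V}
    (hx : x ∈ geomSimplex σ) {a b : V} (ha : 0 < x a) (hb : 0 < x b) (hab : f a + 1 ≤ f b) :
    GrowsAlong n (fun q => vertexFunctional f (triangulationInverse hF.toIsSmoothTriangulation q))
      (F x) (simplexDeriv n F σ x (vertexVec b - vertexVec a)) := by
  have hS := hF.toIsSmoothTriangulation
  intro q hq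
  obtain ⟨R, hR, hRt⟩ := Metric.isOpen_iff.1 (isOpen_extChartAt_target (I := 𝓡 n) q) _
    ((extChartAt (𝓡 n) q).map_source hq)
  have hY₀ :
      triangulationInverse hS ((extChartAt (𝓡 n) q).symm (extChartAt (𝓡 n) q (F x))) = x := by
    rw [(extChartAt (𝓡 n) q).left_inv hq, triangulationInverse_apply hS hσ hx]
  have hlines := exists_growth_along_lines
    (J := {τ : Finset V // τ ∈ X.faces}) (fun τ => geomSimplex τ.1)
    (fun τ => isClosed_geomSimplex τ.1) (G := extChartAt (𝓡 n) q ∘ F)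
    (Y := fun y => triangulationInverse hS ((extChartAt (𝓡 n) q).symm y))
    (y₀ := extChartAt (𝓡 n) q (F x))
    (Z₀ := chartVector q (simplexDeriv n F σ x (vertexVec b - vertexVec a))) hR
    ((continuous_triangulationInverse hS).comp_continuousOn
      ((continuousOn_extChartAt_symm q).mono hRt))
    (fun y _ => by
      obtain ⟨τ, hτ, h⟩ := exists_triangulationInverse_mem hS ((extChartAt (𝓡 n) q).symm y)
      exact ⟨⟨τ, hτ⟩, h⟩)
    (fun y hy => by
      rw [Function.comp_apply, apply_triangulationInverse hS,
        (extChartAt (𝓡 n) q).right_inv (hRt hy)])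
    (vertexFunctional f)
  obtain ⟨r, hr, hrR, h⟩ := hlines <| by
    rintro ⟨τ, hτ⟩ hxτ
    simp only [hY₀] at hxτ ⊢
    obtain ⟨hC, A, hA, hAd⟩ := hS.exists_hasFDerivWithinAt hτ hxτ hq
    obtain ⟨m, hm, hmA⟩ := exists_mul_norm_le_of_injOn_submodule A
      (vectorSpan ℝ (geomSimplex τ)) (fun u hu hAu => by
        refine hF.eq_zero_of_simplexDeriv_eq_zero hc₀ hε hτ hxτ hu (chartVector_injective hq ?_)
        rw [← hAd, hAu]
        exact (map_zero (mfderiv (𝓡 n) 𝓘(ℝ, EuclideanSpace ℝ (Fin n))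
          (extChartAt (𝓡 n) q) (F x))).symm)
    have hξ := sub_mem_vectorSpan_geomSimplex (vertexVec_mem_geomSimplex (mem_of_apply_pos hxτ ha))
      (vertexVec_mem_geomSimplex (mem_of_apply_pos hxτ hb))
    have key := exists_linear_growth_on_convex (convex_geomSimplex τ) hxτ hC hA hm hmA hξ
      (vertexFunctional f) (by
        rw [map_sub, vertexFunctional_vertexVec, vertexFunctional_vertexVec]; linarith)
    have e : A (vertexVec b - vertexVec a)
        = chartVector q (simplexDeriv n F σ x (vertexVec b - vertexVec a)) := by
      rw [hAd, hS.simplexDeriv_edge_eq hτ hσ hxτ hx ha hb]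
    rw [e] at key
    exact key
  exact ⟨r, hr, (ball_subset_ball hrR).trans hRt, h⟩

end GrowthOfSimplicialFunctions


/-! ### Bounding the width -/

section WidthBound

open Filter Topology

variable {n : ℕ} {N : Type*} [TopologicalSpace N] [ChartedSpace (EuclideanSpace ℝ (Fin n)) N]

theorem exists_inclusionDeriv_eq (U : Opens N) (x : U) (v : TangentSpace (𝓡 n) (x : N)) :
    ∃ w : TangentSpace (𝓡 n) x, inclusionDeriv n U x w = v := by
  rw [inclusionDeriv_eq_id]
  exact ⟨v, rfl⟩

variable [IsManifold (𝓡 n) ∞ N]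

omit [IsManifold (𝓡 n) ∞ N] in
theorem differential_comp_val {h : N → ℝ} (U : Opens N) (x : U)
    (hh : MDifferentiableAt (𝓡 n) 𝓘(ℝ, ℝ) h (x : N)) (w : TangentSpace (𝓡 n) x) :
    differential n (fun y : U => h y) x w = differential n h (x : N) (inclusionDeriv n U x w) :=
  mfderiv_comp_apply (f := (Subtype.val : U → N)) x hh
    ((contMDiff_subtype_val (n := 1)).mdifferentiableAt (by simp)) w

/-- A linear form is bounded on the unit ball of a Riemannian metric. -/
theorem exists_abs_le_of_metric_le_one (g : SmoothMetric n N) (p : N)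
    (A : TangentSpace (𝓡 n) p →L[ℝ] ℝ) :
    ∃ B : ℝ, ∀ v, g.inner p v v ≤ 1 → |A v| ≤ B := by
  obtain ⟨B, hB⟩ := ((NormedSpace.isVonNBounded_iff ℝ).1
    ((g.isVonNBounded p).image A)).exists_norm_le
  refine ⟨2 * B, fun v hv => ?_⟩
  have h1 : g.inner p ((2 : ℝ)⁻¹ • v) ((2 : ℝ)⁻¹ • v) < 1 := by
    rw [map_smul, map_smul, smul_apply, smul_eq_mul, smul_eq_mul]
    linarith
  have h2 := hB _ ⟨_, h1, rfl⟩
  rw [map_smul, norm_smul, Real.norm_eq_abs, Real.norm_eq_abs, abs_of_pos (by norm_num)] at h2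
  linarith

/-- On an open subset, `|dh| ≥ 1` holds as soon as `dh` is at least `1` on a vector of length at
most `1` of the ambient manifold. -/
theorem one_le_normDifferential_restrict (g : SmoothMetric n N) {h : N → ℝ} (U : Opens N) (x : U)
    (hh : MDifferentiableAt (𝓡 n) 𝓘(ℝ, ℝ) h (x : N)) {v : TangentSpace (𝓡 n) (x : N)}
    (hv : g.inner (x : N) v v ≤ 1) (hd : 1 ≤ differential n h (x : N) v) :
    1 ≤ normDifferential (restrictMetric g.inner U) (fun y : U => h y) x := by
  obtain ⟨w, rfl⟩ := exists_inclusionDeriv_eq U x v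
  obtain ⟨B, hB⟩ := exists_abs_le_of_metric_le_one g (x : N) (differential n h (x : N))
  have hbdd : BddAbove {r : ℝ | ∃ v : TangentSpace (𝓡 n) x,
      restrictMetric g.inner U x v v ≤ 1 ∧ r = |differential n (fun y : U => h y) x v|} := by
    refine ⟨B, ?_⟩
    rintro _ ⟨u, hu, rfl⟩
    rw [differential_comp_val U x hh]
    exact hB _ hu
  refine le_trans ?_ (le_csSup hbdd ⟨w, hv, rfl⟩)
  rw [differential_comp_val U x hh]
  exact hd.trans (le_abs_self _)

/-- A smooth function `H` on the closed manifold `N` bounds `w_U(K)` even if its restriction to `U`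
is not compactly supported: it may be cut off outside a neighbourhood of `K`. As the range of `H`
is enlarged to an interval `[α, β]` containing `0`, the cut-off does not leave this interval. -/
theorem widthOf_restrict_le [T2Space N] [CompactSpace N] (g : SmoothMetric n N) (U : Opens N)
    {K : Set U} (hK : IsCompact K) {H : N → ℝ} (hH : ContMDiff (𝓡 n) 𝓘(ℝ, ℝ) ∞ H) {α β ℓ : ℝ}
    (hα : α ≤ 0) (hβ : 0 ≤ β) (hℓ : 0 < ℓ) (hHI : ∀ x, H x ∈ Set.Icc α β)
    (hgrad : ∀ x ∈ K, ∃ v : TangentSpace (𝓡 n) (x : N),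
      g.inner (x : N) v v ≤ ℓ ^ 2 ∧ 1 / 2 ≤ differential n H (x : N) v) :
    widthOf (restrictMetric g.inner U) K ≤ ENNReal.ofReal (2 * ℓ * (β - α)) := by
  have hK' : IsCompact (Subtype.val '' K : Set N) := hK.image continuous_subtype_val
  obtain ⟨L, hL, hKL, hLU⟩ := exists_compact_between hK' U.isOpen (by
    rintro _ ⟨x, -, rfl⟩
    exact x.2)
  obtain ⟨θ, hθ1, hθ0, hθI⟩ := exists_contMDiffMap_one_nhds_of_subset_interior (n := ⊤) (𝓡 n)
    hK'.isClosed hKL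
  set h : N → ℝ := fun x => 2 * ℓ * (θ x * H x) with hh
  have hsm : ContMDiff (𝓡 n) 𝓘(ℝ, ℝ) ∞ h := contMDiff_const.mul (θ.contMDiff.mul hH)
  have hbound : ∀ x, h x ∈ Set.Icc (2 * ℓ * α) (2 * ℓ * β) := by
    intro x
    obtain ⟨h1, h2⟩ := hHI x
    obtain ⟨h3, h4⟩ := hθI x
    have h5 : α ≤ θ x * H x := by nlinarith
    have h6 : θ x * H x ≤ β := by nlinarith
    exact ⟨mul_le_mul_of_nonneg_left h5 (by positivity),
      mul_le_mul_of_nonneg_left h6 (by positivity)⟩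
  have hcs : HasCompactSupport (fun y : U => h y) := by
    have hpre : IsCompact ((Subtype.val : U → N) ⁻¹' L) :=
      (Topology.IsInducing.subtypeVal.isCompact_preimage_iff
        (by rw [Subtype.range_coe]; exact hLU)).2 hL
    refine HasCompactSupport.intro hpre fun x hx => ?_
    simp only [hh, hθ0 (x : N) hx, zero_mul, mul_zero]
  have hd : ∀ x ∈ K, 1 ≤ normDifferential (restrictMetric g.inner U) (fun y : U => h y) x := by
    intro x hx
    obtain ⟨v, hv, hvH⟩ := hgrad x hx
    have hloc : h =ᶠ[𝓝 (x : N)] fun y => (2 * ℓ) • H y := by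
      filter_upwards [hθ1.filter_mono (nhds_le_nhdsSet (Set.mem_image_of_mem _ hx))] with y hy
      simp only [hh, hy, one_mul, smul_eq_mul]
    have hHd := (hH.contMDiffAt (x := (x : N))).mdifferentiableAt (by simp)
    have hdiff : ∀ w, differential n h (x : N) w = 2 * ℓ * differential n H (x : N) w := by
      intro w
      rw [differential, hloc.mfderiv_eq]
      have := (hHd.hasMFDerivAt.const_smul (2 * ℓ)).mfderiv
      exact congrArg (fun A : TangentSpace (𝓡 n) (x : N) →L[ℝ] ℝ => A w) this
    refine one_le_normDifferential_restrict g U x (v := ℓ⁻¹ • v)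
      (hsm.contMDiffAt.mdifferentiableAt (by simp)) ?_ ?_
    · rw [map_smul, map_smul, smul_apply, smul_eq_mul, smul_eq_mul, ← mul_assoc, ← sq, inv_pow]
      rw [inv_mul_le_iff₀ (by positivity), mul_one]
      exact hv
    · rw [hdiff, map_smul, smul_eq_mul]
      have : 2 * ℓ * (ℓ⁻¹ * differential n H (x : N) v) = 2 * differential n H (x : N) v := by
        field_simp
      rw [this]
      linarith
  refine iInf₂_le_of_le (fun y : U => h y) (hsm.comp contMDiff_subtype_val) ?_
  refine iInf₂_le_of_le hcs hd (ENNReal.ofReal_le_ofReal ?_)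
  have h1 : ⨆ x : U, h x ≤ 2 * ℓ * β := Real.iSup_le (fun x => (hbound x).2) (by positivity)
  have h2 : 2 * ℓ * α ≤ ⨅ x : U, h x :=
    Real.le_iInf (fun x => (hbound x).1) (mul_nonpos_of_nonneg_of_nonpos (by positivity) hα)
  linarith

/-- Every point that is not a vertex of a thick triangulation admits a tangent vector of length
`√2 c₁ ε` at most along which the simplexwise linear extension of a proper colouring grows. -/
theorem IsThickTriangulation.exists_growsAlong {V : Type*} [Fintype V]
    {X : AbstractSimplicialComplex V} {F : VertexSpace V → N} {g : TangentForm n N} {c₀ c₁ : ℝ}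
    {c₂ : ℕ} {ε : ℝ} (hF : IsThickTriangulation g c₀ c₁ c₂ ε X F) (hc₀ : 0 < c₀) (hε : 0 < ε)
    {f : V → ℕ} (hf : ∀ u w, w ∈ vertexNeighbors X u → f u ≠ f w) {p : N}
    (hp : ∀ v, F (vertexVec v) ≠ p) :
    ∃ Z : TangentSpace (𝓡 n) p,
      GrowsAlong n (fun q => vertexFunctional (fun v => (f v : ℝ))
        (triangulationInverse hF.toIsSmoothTriangulation q)) p Z ∧
      g p Z Z ≤ 2 * (c₁ * ε) ^ 2 := by
  classical
  have hS := hF.toIsSmoothTriangulation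
  obtain ⟨σ, hσ, hx⟩ := exists_triangulationInverse_mem hS p
  have hFx := apply_triangulationInverse hS p
  generalize triangulationInverse hS p = x at hx hFx
  subst hFx
  obtain ⟨a, b, hab, ha, hb, hlt⟩ : ∃ a b, a ≠ b ∧ 0 < x a ∧ 0 < x b ∧ f a < f b := by
    obtain ⟨a, b, hab, ha, hb⟩ := exists_two_pos_of_ne_vertexVec hx fun v hv => hp v (by rw [hv])
    have hadj : b ∈ vertexNeighbors X a :=
      ⟨hab.symm, by
        convert edge_mem_faces hσ (mem_of_apply_pos hx ha) (mem_of_apply_pos hx hb)⟩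
    rcases lt_or_gt_of_ne (hf a b hadj) with h | h
    · exact ⟨a, b, hab, ha, hb, h⟩
    · exact ⟨b, a, hab.symm, hb, ha, h⟩
  refine ⟨_, hF.growsAlong_edge hc₀ hε hσ hx ha hb (by exact_mod_cast hlt), ?_⟩
  have hξ := sub_mem_vectorSpan_geomSimplex (vertexVec_mem_geomSimplex (mem_of_apply_pos hx ha))
    (vertexVec_mem_geomSimplex (mem_of_apply_pos hx hb))
  have hn := norm_edge_sq hab
  have hne : vertexVec b - vertexVec a ≠ 0 := fun h => by
    rw [h, norm_zero] at hn
    norm_num at hn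
  have h1 := (hF.thick σ hσ x hx _ hξ hne).2
  rw [div_le_iff₀ (norm_pos_iff.2 hne)] at h1
  have h2 := (Real.sqrt_le_iff.1 h1).2
  rwa [mul_pow, hn, mul_comm] at h2

end WidthBound

end

theorem proposition4p1 (n : ℕ) (c₀ c₁ : ℝ) (c₂ : ℕ) (hc₀ : 0 < c₀) (hc₁ : 0 < c₁) (hc₂ : 0 < c₂) :
    ∃ C : ℝ, 0 < C ∧
      ∀ (N : Type*) [TopologicalSpace N] [T2Space N] [CompactSpace N]
        [ChartedSpace (EuclideanSpace ℝ (Fin n)) N] [IsManifold (𝓡 n) ∞ N]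
        (g : SmoothMetric n N) (ε : ℝ) (_ : 0 < ε)
        (V : Type*) (X : AbstractSimplicialComplex V) (F : VertexSpace V → N)
        (hF : IsThickTriangulation (n := n) g.inner c₀ c₁ c₂ ε X F),
        width (restrictMetric g.inner (vertexComplement hF.toIsSmoothTriangulation))
          ≤ ENNReal.ofReal (C * ε) := by
  refine ⟨4 * c₁ * (c₂ + 2), by positivity, ?_⟩
  intro N _ _ _ _ _ g ε hε V X F hF
  have hS := hF.toIsSmoothTriangulation
  have : Finite V := finite_vertices hS
  have : Fintype V := Fintype.ofFinite V
  obtain ⟨f, hfk, hf⟩ := exists_colouring X c₂ hF.degree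
  set φ : N → ℝ := fun q => vertexFunctional (fun v => (f v : ℝ)) (triangulationInverse hS q)
    with hφdef
  have hφ : Continuous φ :=
    (vertexFunctional _).continuous.comp (continuous_triangulationInverse hS)
  have hφI : ∀ q, φ q ∈ Set.Icc 0 (c₂ : ℝ) := fun q => by
    obtain ⟨σ, -, hx⟩ := exists_triangulationInverse_mem hS q
    exact vertexFunctional_mem_Icc (fun v => ⟨Nat.cast_nonneg _, by exact_mod_cast hfk v⟩) hx
  refine iSup₂_le fun K hK => ?_
  obtain ⟨H, hH, hHφ, hHd⟩ := exists_smooth_approx_of_growsAlong g hφ (a := (2 * c₁ * ε) ^ 2)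
    (hK.image continuous_subtype_val) (by
      rintro _ ⟨x, -, rfl⟩
      obtain ⟨Z, hZ, hgZ⟩ := hF.exists_growsAlong hc₀ hε hf (p := (x : N))
        fun v hv => x.2 ⟨v, hv⟩
      -- `2 (c₁ ε)² < (2 c₁ ε)²` leaves room for the passage from `x` to nearby points
      refine ⟨Z, hZ, hgZ.trans_lt ?_⟩
      have : 0 < (c₁ * ε) ^ 2 := by positivity
      linarith)
  refine (widthOf_restrict_le g _ hK hH (α := -1) (β := c₂ + 1) (ℓ := 2 * c₁ * ε) (by norm_num)
    (by positivity) (by positivity) (fun q => ?_) fun x hx => hHd x ⟨x, hx, rfl⟩).trans_eq ?_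
  -- `φ` takes values in `[0, c₂]` and `|H - φ| ≤ 1`
  · obtain ⟨h1, h2⟩ := hφI q
    obtain ⟨h3, h4⟩ := abs_le.1 (hHφ q)
    exact ⟨by linarith, by linarith⟩
  · congr 1
    ring
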